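/- Let $d\in\{2,3\}$ and let $\Omega\subset\mathbb R^d$ be a bounded polyhedral domain (open and connected) with Lipschitz boundary $\Gamma$ and outward unit normal $\mathbf n$. Let $\mathcal T_h$ be a conforming simplicial triangulation of $\Omega$. Let $\boldsymbol\beta\in C(\overline\Omega)^d$ satisfy $\operatorname{div}\boldsymbol\beta=0$ in $\Omega$ (in the sense of distributions) and $\boldsymbol\beta\cdot\mathbf n=0$ on $\Gamma$, let $\sigma\in L^\infty(\Omega)$ satisfy $\sigma\ge\sigma_0$ a.e. in $\Omega$ for some constant $\sigma_0>0$, and let $\mathbf f\in L^2(\Omega)^d$. Let $\mathcal P_k(T)$ be the polynomials of total degree at most $k$ on $T$, let $\mathbf{RT}_k(T)=\mathcal P_k(T)^d+\mathcal P_k(T)\,\mathbf x$, and let $\mathbf H_0(\operatorname{div},\Omega)$ be the space of fields in $L^2(\Omega)^d$ with distributional divergence in $L^2(\Omega)$ and vanishing normal trace on $\Gamma$. Define $$\mathbf V^{RT}_{h,k}=\{\mathbf v\in\mathbf H_0(\operatorname{div},\Omega):\mathbf v|_T\in\mathbf{RT}_k(T)\ \forall T\in\mathcal T_h\},\qquad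 \mathbf V^{BDM}_{h,k}=\{\mathbf v\in\mathbf H_0(\operatorname{div},\Omega):\mathbf v|_T\in\mathcal P_k(T)^d\ \forall T\in\mathcal T_h\},$$ $$M_{h,k}=\Big\{q\in L^2(\Omega):\int_\Omega q\,dx=0,\ q|_T\in\mathcal P_k(T)\ \forall T\in\mathcal T_h\Big\}.$$ For a velocity space $\mathbf V_h$ and a pressure space $M_h$, the upwind method is: find $(\mathbf u_h,p_h)\in\mathbf V_h\times M_h$ such that, for all $\mathbf v_h\in\mathbf V_h$ and all $q_h\in M_h$, $$-\sum_{T\in\mathcal T_h}\int_T\mathbf u_h\cdot(\boldsymbol\beta\cdot\nabla\mathbf v_h)\,dx+\sum_{T\in\mathcal T_h}\int_{\partial T}(\boldsymbol\beta\cdot\mathbf n)\,\widehat{\mathbf u_h}\cdot\mathbf v_h\,ds+\int_\Omega\sigma\,\mathbf u_h\cdot\mathbf v_h\,dx-\int_\Omega p_h\operatorname{div}\mathbf v_h\,dx=\int_\Omega\mathbf f\cdot\mathbf v_h\,dx,$$ $$\int_\Omega q_h\operatorname{div}\mathbf u_h\,dx=0.$$ Here, on $\partial T$, $\mathbf n$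 is the outward unit normal of $T$, $\mathbf v_h$ is the trace from inside $T$, and $\widehat{\mathbf u_h}(\mathbf x)=\lim_{\epsilon\to0^+}\mathbf u_h\big(\mathbf x-\epsilon(\boldsymbol\beta(\mathbf x)\cdot\mathbf n(\mathbf x))\,\mathbf n(\mathbf x)\big)$ is the upwind value. Let $k\ge1$. Let $(\mathbf u_h,p_h)$ be a solution of the method for $\mathbf V_h\times M_h=\mathbf V^{RT}_{h,k}\times M_{h,k}$ and let $(\tilde{\mathbf u}_h,\tilde p_h)$ be a solution for $\mathbf V_h\times M_h=\mathbf V^{BDM}_{h,k}\times M_{h,k-1}$, with the same data. Then $\mathbf u_h=\tilde{\mathbf u}_h$ (as elements of $L^2(\Omega)^d$). -/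

import Mathlib

open MeasureTheory Set Filter Topology
open scoped ContDiff

noncomputable section

namespace HdivUpwind

/-- The Euclidean space `ℝ^d`. -/
abbrev Euc (d : ℕ) := EuclideanSpace ℝ (Fin d)

/-! ### The domain -/

/-- `Ω` has a Lipschitz boundary: near each boundary point, in a suitable direction `e`, the set
`Ω` lies below the graph of a Lipschitz function `g` of the component of `x` orthogonal to `e`. -/
def HasLipschitzBoundary {d : ℕ} (Ω : Set (Euc d)) : Prop :=
  ∀ x₀ ∈ frontier Ω, ∃ e : Euc d, ‖e‖ = 1 ∧ ∃ r : ℝ, 0 < r ∧ ∃ L : NNReal, ∃ g : Euc d → ℝ,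
    LipschitzWith L g ∧
      ∀ x ∈ Metric.ball x₀ r, x ∈ Ω ↔ inner ℝ e x < g (x - inner ℝ e x • e)

/-! ### Weak divergence, `H(div, Ω)` and `H₀(div, Ω)` -/

/-- `g ∈ L²(Ω)` is the distributional divergence of the vector field `v` in `Ω`. -/
def IsWeakDiv {d : ℕ} (Ω : Set (Euc d)) (v : Euc d → Euc d) (g : Euc d → ℝ) : Prop :=
  MemLp g 2 (volume.restrict Ω) ∧
    ∀ φ : Euc d → ℝ, ContDiff ℝ ∞ φ → HasCompactSupport φ → tsupport φ ⊆ Ω →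
      (∫ x in Ω, fderiv ℝ φ x (v x)) = -(∫ x in Ω, g x * φ x)

/-- The distributional divergence of `v` in `Ω`, well defined up to almost everywhere equality
whenever `v` has a distributional divergence in `L²(Ω)`. -/
def weakDiv {d : ℕ} (Ω : Set (Euc d)) (v : Euc d → Euc d) : Euc d → ℝ :=
  Classical.epsilon (IsWeakDiv Ω v)

/-- Membership in `H(div, Ω)`. -/
def MemHdiv {d : ℕ} (Ω : Set (Euc d)) (v : Euc d → Euc d) : Prop :=
  MemLp v 2 (volume.restrict Ω) ∧ ∃ g, IsWeakDiv Ω v g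

/-- The normal trace of `v ∈ H(div, Ω)` on `∂Ω`, as a functional:
`⟨v · n, φ⟩ = ∫_Ω v · ∇φ + (div v) φ`. -/
def normalTrace {d : ℕ} (Ω : Set (Euc d)) (v : Euc d → Euc d) (φ : Euc d → ℝ) : ℝ :=
  ∫ x in Ω, (fderiv ℝ φ x (v x) + weakDiv Ω v x * φ x)

/-- Membership in `H₀(div, Ω)`: the normal trace vanishes. The test functions are the restrictions
to `Ω` of the functions in `C_c^∞(ℝ^d)`, which are dense in `H¹(Ω)` for a Lipschitz domain. -/
def MemHdivZero {d : ℕ} (Ω : Set (Euc d)) (v : Euc d → Euc d) : Prop :=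
  MemHdiv Ω v ∧
    ∀ φ : Euc d → ℝ, ContDiff ℝ ∞ φ → HasCompactSupport φ → normalTrace Ω v φ = 0

/-! ### Simplicial triangulations -/

/-- A (conforming, finite) simplicial triangulation of `Ω ⊆ ℝ^d`: a finite geometric simplicial
complex, all of whose faces belong to `d`-simplices, which covers exactly the closure of `Ω`. -/
structure Triangulation {d : ℕ} (Ω : Set (Euc d)) where
  complex : Geometry.SimplicialComplex ℝ (Euc d)
  finite : complex.faces.Finite
  pure : ∀ s ∈ complex.faces, ∃ t ∈ complex.faces, s ⊆ t ∧ t.card = d + 1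
  space_eq : complex.space = closure Ω

/-- The elements of the triangulation, each given by its `d + 1` vertices. -/
def Triangulation.elements {d : ℕ} {Ω : Set (Euc d)} (𝒯 : Triangulation Ω) :
    Finset (Finset (Euc d)) :=
  𝒯.finite.toFinset.filter (fun T => T.card = d + 1)

/-- The open simplex with vertex set `T`. -/
def openCell {d : ℕ} (T : Finset (Euc d)) : Set (Euc d) :=
  interior (convexHull ℝ (T : Set (Euc d)))

/-- The (closed) facet of the simplex `T` opposite to its vertex `a`. -/
def facet {d : ℕ} (T : Finset (Euc d)) (a : Euc d) : Set (Euc d) :=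
  convexHull ℝ ((T : Set (Euc d)) \ {a})

/-- A vector normal to the facet of `T` opposite to `a` and pointing out of `T`: the component
orthogonal to that facet of the sum of the edge vectors of `T` that start at `a`. -/
def outwardVector {d : ℕ} (T : Finset (Euc d)) (a : Euc d) : Euc d :=
  (vectorSpan ℝ ((T : Set (Euc d)) \ {a}))ᗮ.starProjection (∑ b ∈ T, (b - a))

/-- The unit normal to the facet of `T` opposite to `a`, pointing out of `T`. -/
def outwardNormal {d : ℕ} (T : Finset (Euc d)) (a : Euc d) : Euc d :=
  ‖outwardVector T a‖⁻¹ • outwardVector T a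

/-- `∫_F g ds` over the facet of `T` opposite to `a`; `ds` is the `(d-1)`-dimensional Euclidean
surface measure. -/
def facetIntegral {d : ℕ} (T : Finset (Euc d)) (a : Euc d) (g : Euc d → ℝ) : ℝ :=
  ∫ x in facet T a, g x ∂(μHE[d - 1] : Measure (Euc d))

/-- `β · n = 0` on `Γ = ∂Ω`: this holds at all points of the facets contained in `∂Ω`. -/
def Triangulation.NormalVanishes {d : ℕ} {Ω : Set (Euc d)} (𝒯 : Triangulation Ω)
    (β : Euc d → Euc d) : Prop :=
  ∀ T ∈ 𝒯.elements, ∀ a ∈ T, facet T a ⊆ frontier Ω →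
    ∀ x ∈ facet T a, inner ℝ (β x) (outwardNormal T a) = 0

/-! ### Finite element spaces

Discrete functions are represented by functions on `ℝ^d` that are given by polynomials on each open
element; their values on the facets and outside of `Ω` are irrelevant. -/

/-- `q` is a polynomial of total degree at most `k` on `S`. -/
def IsPolyOn {d : ℕ} (k : ℕ) (S : Set (Euc d)) (q : Euc d → ℝ) : Prop :=
  ∃ P : MvPolynomial (Fin d) ℝ, P.totalDegree ≤ k ∧
    ∀ x ∈ S, q x = MvPolynomial.eval (fun i => x i) P

/-- `v` belongs to `P_k(S)^d`. -/
def IsVecPolyOn {d : ℕ} (k : ℕ) (S : Set (Euc d)) (v : Euc d → Euc d) : Prop :=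
  ∀ i, IsPolyOn k S (fun x => v x i)

/-- `v` belongs to `RT_k(S) = P_k(S)^d + P_k(S) x`. -/
def IsRTOn {d : ℕ} (k : ℕ) (S : Set (Euc d)) (v : Euc d → Euc d) : Prop :=
  ∃ (w : Euc d → Euc d) (q : Euc d → ℝ), IsVecPolyOn k S w ∧ IsPolyOn k S q ∧
    ∀ x ∈ S, v x = w x + q x • x

/-- The Raviart-Thomas space of order `k`. -/
def spaceRT {d : ℕ} {Ω : Set (Euc d)} (𝒯 : Triangulation Ω) (k : ℕ) : Set (Euc d → Euc d) :=
  {v | MemHdivZero Ω v ∧ ∀ T ∈ 𝒯.elements, IsRTOn k (openCell T) v}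

/-- The Brezzi-Douglas-Marini space of order `k`. -/
def spaceBDM {d : ℕ} {Ω : Set (Euc d)} (𝒯 : Triangulation Ω) (k : ℕ) : Set (Euc d → Euc d) :=
  {v | MemHdivZero Ω v ∧ ∀ T ∈ 𝒯.elements, IsVecPolyOn k (openCell T) v}

/-- The discontinuous piecewise polynomials of degree at most `k` with mean value zero. -/
def spaceM {d : ℕ} {Ω : Set (Euc d)} (𝒯 : Triangulation Ω) (k : ℕ) : Set (Euc d → ℝ) :=
  {q | MemLp q 2 (volume.restrict Ω) ∧ (∫ x in Ω, q x) = 0 ∧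
    ∀ T ∈ 𝒯.elements, IsPolyOn k (openCell T) q}

/-! ### The upwind method -/

/-- The upwind value `lim_{ε → 0+} v (x - ε (β(x) · n) n)` at a point `x` of a facet with unit
normal `n`. -/
def upwindValue {d : ℕ} (β v : Euc d → Euc d) (n x : Euc d) : Euc d :=
  limUnder (𝓝[>] (0 : ℝ)) (fun ε : ℝ => v (x - ε • (inner ℝ (β x) n • n)))

/-- The trace `lim_{ε → 0+} v (x - ε n)` at a point `x` of a facet from within the simplex with
outward unit normal `n`. -/
def innerTrace {d : ℕ} (v : Euc d → Euc d) (n x : Euc d) : Euc d :=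
  limUnder (𝓝[>] (0 : ℝ)) (fun ε : ℝ => v (x - ε • n))

/-- `(u, β · ∇v)_h`, the sum over all elements. -/
def convTerm {d : ℕ} {Ω : Set (Euc d)} (𝒯 : Triangulation Ω) (β u v : Euc d → Euc d) : ℝ :=
  ∑ T ∈ 𝒯.elements, ∫ x in openCell T, inner ℝ (u x) (fderiv ℝ v x (β x))

/-- `⟨(β · n) û, v⟩_h`, the sum over all element boundaries. -/
def fluxTerm {d : ℕ} {Ω : Set (Euc d)} (𝒯 : Triangulation Ω) (β u v : Euc d → Euc d) : ℝ :=
  ∑ T ∈ 𝒯.elements, ∑ a ∈ T, facetIntegral T a (fun x =>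
    inner ℝ (β x) (outwardNormal T a) *
      inner ℝ (upwindValue β u (outwardNormal T a) x) (innerTrace v (outwardNormal T a) x))

/-- `(u, p) ∈ V × M` solves the upwind method with velocity space `V` and pressure space `M`. -/
structure IsUpwindSolution {d : ℕ} {Ω : Set (Euc d)} (𝒯 : Triangulation Ω)
    (β : Euc d → Euc d) (σ : Euc d → ℝ) (f : Euc d → Euc d)
    (V : Set (Euc d → Euc d)) (M : Set (Euc d → ℝ)) (u : Euc d → Euc d) (p : Euc d → ℝ) :
    Prop where
  velocity_mem : u ∈ V
  pressure_mem : p ∈ M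
  momentum : ∀ v ∈ V,
    -(convTerm 𝒯 β u v) + fluxTerm 𝒯 β u v + (∫ x in Ω, σ x * inner ℝ (u x) (v x))
      - (∫ x in Ω, p x * weakDiv Ω v x) = ∫ x in Ω, inner ℝ (f x) (v x)
  continuity : ∀ q ∈ M, (∫ x in Ω, weakDiv Ω u x * q x) = 0

end HdivUpwind

end

/-!
Both velocities turn out to be exactly divergence free, and on divergence-free fields the two
methods are the same. The divergence of a discrete velocity is a piecewise polynomial of mean value
zero (the normal trace vanishes), and of degree low enough to be an admissible pressure test
function, so the discrete continuity equation forces it to vanish (`IsPiecewise.polyDiv_eq_zero`). A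
divergence-free field in `P_k^d + P_k x` lies in `P_k^d`, as comparing the homogeneous parts of
degree `k` of the divergence shows (`totalDegree_le_of_polyDiv_eq_zero`). Hence the difference `w`
of the two velocities belongs to both velocity spaces and is divergence free. Testing both momentum
equations with `w` eliminates the pressures, and subtracting them leaves
`- (w, β · ∇w)_h + ⟨(β · n) ŵ, w⟩_h + ∫ σ |w|² = 0`.

The first two terms together are nonnegative (`convTerm_self_le_fluxTerm_self`), so `σ ≥ σ₀ > 0`
yields `w = 0`. For this, `(w, β · ∇w)` on an element is half the integral of `β · ∇|w|²`, which the
divergence theorem turns into an integral over the facets. The contributions of the two sides of an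
interior facet then add up to `|β · n| |[w]|² / 2`, with `[w]` the jump of `w`
(`fluxDensity_add_eq`), and `β · n` vanishes on the facets in the boundary.

Since `β` is merely continuous and divergence free in the sense of distributions, the divergence
theorem on a simplex (`IsSimplex.integral_fderiv_eq_sum_facetIntegral`) is proved by testing with
`φ ∏ b, θ(λ_b / ε)`, where the `λ_b` are the barycentric coordinates and `θ` is a smooth cutoff. The
derivatives of the cutoff concentrate on the facets as `ε → 0` (`IsSimplex.tendsto_strip`), by
slicing parallel to the facet, rescaling the normal coordinate by `ε`, and dominated convergence.
The surface measure of a facet is Lebesgue measure on its hyperplane (`map_hyperplane`). That every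
facet is either contained in the boundary or shared by exactly two elements, on opposite sides,
follows from the intersection property of the simplicial complex (`Triangulation.exists_neighbor`,
`Triangulation.outwardNormal_neighbor`, `Triangulation.eq_or_eq_of_erase_eq`).
-/

namespace HdivUpwind

variable {d : ℕ}

/-! ### Barycentric coordinates of a simplex -/

/-- `T` is the vertex set of a nondegenerate `d`-simplex in `ℝ^d`. -/
def IsSimplex (T : Finset (Euc d)) : Prop :=
  AffineIndependent ℝ ((↑) : T → Euc d) ∧ T.card = d + 1

/-- `x ↦ ⟪g a, x⟫ + c a`, `a ∈ T`, are the barycentric coordinates of the simplex `T`. -/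
structure IsBary (T : Finset (Euc d)) (g : Euc d → Euc d) (c : Euc d → ℝ) : Prop where
  apply_vertex : ∀ a ∈ T, ∀ b ∈ T, inner ℝ (g a) b + c a = if a = b then 1 else 0
  sum_eq_one : ∀ x, ∑ a ∈ T, (inner ℝ (g a) x + c a) = 1
  sum_smul : ∀ x, ∑ a ∈ T, (inner ℝ (g a) x + c a) • a = x

lemma IsSimplex.exists_isBary {T : Finset (Euc d)} (hT : IsSimplex T) :
    ∃ gc : (Euc d → Euc d) × (Euc d → ℝ), IsBary T gc.1 gc.2 := by
  classical
  let B : AffineBasis T ℝ (Euc d) := ⟨(↑), hT.1, by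
    rw [hT.1.affineSpan_eq_top_iff_card_eq_finrank_add_one]
    simp [hT.2]⟩
  have hB : ∀ i : T, B i = (i : Euc d) := fun i => rfl
  let G : T → Euc d := fun i =>
    (InnerProductSpace.toDual ℝ (Euc d)).symm (LinearMap.toContinuousLinearMap (B.coord i).linear)
  let g : Euc d → Euc d := fun a => if h : a ∈ T then G ⟨a, h⟩ else 0
  let c : Euc d → ℝ := fun a => if h : a ∈ T then B.coord ⟨a, h⟩ 0 else 0
  have key : ∀ i : T, ∀ x, inner ℝ (g i) x + c i = B.coord i x := by
    intro i x
    have h1 : inner ℝ (g i) x = (B.coord i).linear x := by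
      simp only [g, G, i.2, dif_pos]
      rw [InnerProductSpace.toDual_symm_apply]
      rfl
    have h2 : c i = B.coord i 0 := by simp [c]
    rw [h1, h2]
    have := (B.coord i).map_vadd 0 x
    simpa using this.symm
  refine ⟨(g, c), ?_, ?_, ?_⟩
  · intro a ha b hb
    have := key ⟨a, ha⟩ b
    simp only at this ⊢
    rw [this]
    have h3 := B.coord_apply ⟨a, ha⟩ ⟨b, hb⟩
    rw [hB] at h3
    simpa using h3
  · intro x
    rw [← Finset.sum_coe_sort]
    simp only [key]
    exact B.sum_coord_apply_eq_one x
  · intro x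
    rw [← Finset.sum_coe_sort]
    simp only [key]
    exact B.linear_combination_coord_eq_self x

open Classical in
/-- The gradient of the barycentric coordinate of `T` belonging to the vertex `a`. -/
noncomputable def baryGrad (T : Finset (Euc d)) (a : Euc d) : Euc d :=
  if h : IsSimplex T then h.exists_isBary.choose.1 a else 0

open Classical in
/-- The value at the origin of the barycentric coordinate of `T` belonging to the vertex `a`. -/
noncomputable def baryConst (T : Finset (Euc d)) (a : Euc d) : ℝ :=
  if h : IsSimplex T then h.exists_isBary.choose.2 a else 0

/-- The barycentric coordinate of `T` belonging to the vertex `a`, as a function on `ℝ^d`. -/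
noncomputable def bary (T : Finset (Euc d)) (a x : Euc d) : ℝ :=
  inner ℝ (baryGrad T a) x + baryConst T a

section

variable {T : Finset (Euc d)} (hT : IsSimplex T) {a b x y : Euc d}
include hT

lemma IsSimplex.bary_vertex (ha : a ∈ T) (hb : b ∈ T) :
    bary T a b = if a = b then 1 else 0 := by
  have := hT.exists_isBary.choose_spec.apply_vertex a ha b hb
  simpa [bary, baryGrad, baryConst, hT] using this

lemma IsSimplex.bary_self (ha : a ∈ T) : bary T a a = 1 := by
  simp [hT.bary_vertex ha ha]

lemma IsSimplex.bary_of_ne (ha : a ∈ T) (hb : b ∈ T) (hab : a ≠ b) : bary T a b = 0 := by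
  simp [hT.bary_vertex ha hb, hab]

lemma IsSimplex.sum_bary (x : Euc d) : ∑ a ∈ T, bary T a x = 1 := by
  have := hT.exists_isBary.choose_spec.sum_eq_one x
  simpa [bary, baryGrad, baryConst, hT] using this

lemma IsSimplex.sum_bary_smul (x : Euc d) : ∑ a ∈ T, bary T a x • a = x := by
  have := hT.exists_isBary.choose_spec.sum_smul x
  simpa [bary, baryGrad, baryConst, hT] using this

end

lemma bary_add (T : Finset (Euc d)) (a x v : Euc d) :
    bary T a (x + v) = bary T a x + inner ℝ (baryGrad T a) v := by
  simp only [bary, inner_add_right]; ring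

lemma bary_add_smul (T : Finset (Euc d)) (a x v : Euc d) (t : ℝ) :
    bary T a (x + t • v) = bary T a x + t * inner ℝ (baryGrad T a) v := by
  rw [bary_add, inner_smul_right]

lemma inner_baryGrad_sub (T : Finset (Euc d)) (a x y : Euc d) :
    inner ℝ (baryGrad T a) (x - y) = bary T a x - bary T a y := by
  simp only [bary, inner_sub_right]; ring

lemma contDiff_bary (T : Finset (Euc d)) (a : Euc d) : ContDiff ℝ ∞ (bary T a) := by
  unfold bary
  exact (contDiff_const.inner ℝ contDiff_id).add contDiff_const

lemma continuous_bary (T : Finset (Euc d)) (a : Euc d) : Continuous (bary T a) :=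
  (contDiff_bary T a).continuous

lemma hasFDerivAt_bary (T : Finset (Euc d)) (a x : Euc d) :
    HasFDerivAt (bary T a) (innerSL ℝ (baryGrad T a)) x := by
  unfold bary
  exact ((innerSL ℝ (baryGrad T a)).hasFDerivAt).add_const _

lemma bary_combination (T : Finset (Euc d)) (a x y : Euc d) {s t : ℝ} (hst : s + t = 1) :
    bary T a (s • x + t • y) = s * bary T a x + t * bary T a y := by
  simp only [bary, inner_add_right, inner_smul_right]
  linear_combination -(baryConst T a) * hst

lemma convex_bary_nonneg (T : Finset (Euc d)) (a : Euc d) : Convex ℝ {x | 0 ≤ bary T a x} := by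
  intro x hx y hy s t hs ht hst
  simp only [mem_ofPred_eq] at *
  rw [bary_combination T a x y hst]
  positivity

lemma convex_bary_eq_zero (T : Finset (Euc d)) (a : Euc d) : Convex ℝ {x | bary T a x = 0} := by
  intro x hx y hy s t _ _ hst
  simp only [mem_ofPred_eq] at *
  rw [bary_combination T a x y hst, hx, hy]
  simp

section

variable {T : Finset (Euc d)} (hT : IsSimplex T) {a b x y : Euc d}
include hT

lemma IsSimplex.mem_convexHull_iff :
    x ∈ convexHull ℝ (T : Set (Euc d)) ↔ ∀ a ∈ T, 0 ≤ bary T a x := by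
  constructor
  · intro hx a ha
    refine convexHull_min ?_ (convex_bary_nonneg T a) hx
    intro b hb
    simp only [mem_ofPred_eq]
    rw [hT.bary_vertex ha hb]
    split_ifs <;> norm_num
  · intro h
    rw [← hT.sum_bary_smul x]
    exact (convex_convexHull ℝ _).sum_mem h (hT.sum_bary x)
      fun b hb => subset_convexHull ℝ _ hb

lemma IsSimplex.mem_facet_iff (ha : a ∈ T) :
    x ∈ facet T a ↔ bary T a x = 0 ∧ ∀ b ∈ T, 0 ≤ bary T b x := by
  constructor
  · intro hx
    refine ⟨?_, hT.mem_convexHull_iff.1 (convexHull_mono sdiff_subset hx)⟩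
    refine convexHull_min ?_ (convex_bary_eq_zero T a) hx
    intro b hb
    exact hT.bary_of_ne ha hb.1 (fun h => hb.2 h.symm)
  · rintro ⟨h0, h⟩
    have h1 := hT.sum_bary_smul x
    have h2 := hT.sum_bary x
    rw [← Finset.add_sum_erase _ _ ha, h0] at h1 h2
    simp only [zero_smul, zero_add] at h1 h2
    rw [← h1]
    refine (convex_convexHull ℝ _).sum_mem (fun b hb => h b (Finset.mem_of_mem_erase hb)) h2 ?_
    intro b hb
    exact subset_convexHull ℝ _ ⟨Finset.mem_of_mem_erase hb, Finset.ne_of_mem_erase hb⟩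

lemma IsSimplex.exists_ne (hd : 1 ≤ d) (a : Euc d) : ∃ b ∈ T, b ≠ a := by
  have : 1 < T.card := by rw [hT.2]; omega
  obtain ⟨b, hb, hba⟩ := Finset.exists_mem_ne this a
  exact ⟨b, hb, hba⟩

lemma IsSimplex.baryGrad_ne_zero (hd : 1 ≤ d) (ha : a ∈ T) : baryGrad T a ≠ 0 := by
  intro h
  obtain ⟨b, hb, hba⟩ := hT.exists_ne hd a
  have := inner_baryGrad_sub T a a b
  rw [h, inner_zero_left, hT.bary_self ha, hT.bary_of_ne ha hb hba.symm] at this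
  norm_num at this

lemma IsSimplex.mem_openCell_iff (hd : 1 ≤ d) :
    x ∈ openCell T ↔ ∀ a ∈ T, 0 < bary T a x := by
  constructor
  · intro hx a ha
    have hx0 := hT.mem_convexHull_iff.1 (interior_subset hx)
    refine lt_of_le_of_ne (hx0 a ha) fun h => ?_
    have hc : Tendsto (fun t : ℝ => x + t • (-baryGrad T a)) (𝓝[>] 0) (𝓝 x) := by
      refine Tendsto.mono_left ?_ nhdsWithin_le_nhds
      have : Continuous fun t : ℝ => x + t • (-baryGrad T a) := by fun_prop
      simpa using this.tendsto 0
    have h1 := hc.eventually (mem_interior_iff_mem_nhds.1 hx)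
    obtain ⟨t, ht, ht0⟩ := (h1.and self_mem_nhdsWithin).exists
    have h2 := hT.mem_convexHull_iff.1 ht a ha
    rw [bary_add_smul, ← h, inner_neg_right, real_inner_self_eq_norm_sq] at h2
    have h3 : 0 < ‖baryGrad T a‖ := norm_pos_iff.2 (hT.baryGrad_ne_zero hd ha)
    have h4 : 0 < t * ‖baryGrad T a‖ ^ 2 := mul_pos ht0 (by positivity)
    linarith
  · intro h
    have ho : IsOpen (⋂ a ∈ T, {x | 0 < bary T a x}) :=
      isOpen_biInter_finset fun a _ => isOpen_lt continuous_const (continuous_bary T a)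
    refine interior_maximal (t := ⋂ a ∈ T, {x | 0 < bary T a x}) ?_ ho (by simpa using h)
    intro y hy
    simp only [mem_iInter, mem_ofPred_eq] at hy
    exact hT.mem_convexHull_iff.2 fun a ha => (hy a ha).le

/-- The hyperplane parallel to a facet is the orthogonal complement of the gradient of the opposite
barycentric coordinate. -/
lemma IsSimplex.vectorSpan_facet (hd : 1 ≤ d) (ha : a ∈ T) :
    vectorSpan ℝ ((T : Set (Euc d)) \ {a}) = (ℝ ∙ baryGrad T a)ᗮ := by
  apply le_antisymm
  · rw [vectorSpan_def, Submodule.span_le]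
    rintro _ ⟨b, hb, b', hb', rfl⟩
    rw [SetLike.mem_coe, Submodule.mem_orthogonal_singleton_iff_inner_right]
    simp only [vsub_eq_sub]
    rw [inner_baryGrad_sub, hT.bary_of_ne ha hb.1 (fun h => hb.2 h.symm),
      hT.bary_of_ne ha hb'.1 (fun h => hb'.2 h.symm), sub_zero]
  · intro z hz
    rw [Submodule.mem_orthogonal_singleton_iff_inner_right] at hz
    obtain ⟨b₀, hb₀, hba⟩ := hT.exists_ne hd a
    have h1 : ∑ b ∈ T, inner ℝ (baryGrad T b) z • b = z := by
      have h := hT.sum_bary_smul (0 + z)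
      simp_rw [bary_add, add_smul] at h
      rw [Finset.sum_add_distrib, hT.sum_bary_smul 0, zero_add, zero_add] at h
      exact h
    have h2 : ∑ b ∈ T, inner ℝ (baryGrad T b) z = 0 := by
      have h := hT.sum_bary (0 + z)
      simp_rw [bary_add] at h
      rw [Finset.sum_add_distrib, hT.sum_bary 0] at h
      linarith
    have h3 : ∑ b ∈ T, inner ℝ (baryGrad T b) z • (b - b₀) = z := by
      simp only [smul_sub, Finset.sum_sub_distrib, h1, ← Finset.sum_smul, h2, zero_smul, sub_zero]
    rw [← h3]
    refine Submodule.sum_mem _ fun b hb => ?_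
    by_cases hab : b = a
    · rw [hab, hz, zero_smul]; exact Submodule.zero_mem _
    · exact Submodule.smul_mem _ _ (vsub_mem_vectorSpan ℝ ⟨hb, hab⟩ ⟨hb₀, hba⟩)

lemma IsSimplex.outwardNormal_eq (hd : 1 ≤ d) (ha : a ∈ T) :
    outwardNormal T a = -(‖baryGrad T a‖⁻¹ • baryGrad T a) := by
  have hg := hT.baryGrad_ne_zero hd ha
  have hg' : 0 < ‖baryGrad T a‖ := norm_pos_iff.2 hg
  have hs : inner ℝ (baryGrad T a) (∑ b ∈ T, (b - a)) = -(d : ℝ) := by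
    rw [inner_sum, ← Finset.add_sum_erase _ _ ha, sub_self, inner_zero_right, zero_add]
    have : ∀ b ∈ T.erase a, inner ℝ (baryGrad T a) (b - a) = (-1 : ℝ) := fun b hb => by
      rw [inner_baryGrad_sub, hT.bary_self ha,
        hT.bary_of_ne ha (Finset.mem_of_mem_erase hb) (Finset.ne_of_mem_erase hb).symm]
      norm_num
    rw [Finset.sum_congr rfl this, Finset.sum_const, Finset.card_erase_of_mem ha, hT.2]
    simp
  have hv : outwardVector T a = (-((d : ℝ) / ‖baryGrad T a‖ ^ 2)) • baryGrad T a := by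
    unfold outwardVector
    simp only [hT.vectorSpan_facet hd ha, Submodule.orthogonal_orthogonal]
    rw [Submodule.starProjection_singleton, hs]
    simp [neg_div]
  have hd' : (0 : ℝ) < d := by exact_mod_cast hd
  unfold outwardNormal
  rw [hv, norm_smul, norm_neg, Real.norm_of_nonneg (by positivity), smul_smul, ← neg_smul]
  congr 1
  field_simp

lemma IsSimplex.norm_outwardNormal (hd : 1 ≤ d) (ha : a ∈ T) : ‖outwardNormal T a‖ = 1 := by
  have hg' : 0 < ‖baryGrad T a‖ := norm_pos_iff.2 (hT.baryGrad_ne_zero hd ha)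
  rw [hT.outwardNormal_eq hd ha, norm_neg, norm_smul, norm_inv, norm_norm]
  exact inv_mul_cancel₀ hg'.ne'

lemma IsSimplex.inner_baryGrad_outwardNormal (hd : 1 ≤ d) (ha : a ∈ T) :
    inner ℝ (baryGrad T a) (outwardNormal T a) = -‖baryGrad T a‖ := by
  have hg' : 0 < ‖baryGrad T a‖ := norm_pos_iff.2 (hT.baryGrad_ne_zero hd ha)
  rw [hT.outwardNormal_eq hd ha, inner_neg_right, inner_smul_right, real_inner_self_eq_norm_sq]
  field_simp

end

lemma isCompact_convexHull_finset (T : Finset (Euc d)) :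
    IsCompact (convexHull ℝ (T : Set (Euc d))) :=
  T.finite_toSet.isCompact_convexHull ℝ

/-! ### Surface integrals and slicing by hyperplanes -/

/-- Lebesgue measure on `ℝ^d` is the product of Lebesgue measures on a line and on its orthogonal
complement. -/
lemma measurePreserving_slice {n : Euc d} (hn : ‖n‖ = 1) (p : Euc d) :
    MeasurePreserving (fun q : ℝ × (ℝ ∙ n)ᗮ => q.1 • n + (q.2 : Euc d) + p) := by
  have h1 := ((ℝ ∙ n).measurePreserving_measurableEquivProd p).symm
  rw [InnerProductSpace.euclideanHausdorffMeasure_eq_volume] at h1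
  have h2 := (LinearIsometryEquiv.toSpanUnitSingleton (𝕜 := ℝ) n hn).measurePreserving
  have h3 := h1.comp (h2.prod (MeasurePreserving.id (volume : Measure (ℝ ∙ n)ᗮ)))
  rw [Measure.volume_eq_prod]
  convert h3 using 1
  funext q
  simp [LinearIsometryEquiv.toSpanUnitSingleton_apply]

lemma isometry_hyperplane (n p : Euc d) : Isometry (fun y : (ℝ ∙ n)ᗮ => (y : Euc d) + p) :=
  (isometry_add_right p).comp isometry_subtype_coe

lemma measurableEmbedding_hyperplane (n p : Euc d) :
    MeasurableEmbedding (fun y : (ℝ ∙ n)ᗮ => (y : Euc d) + p) :=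
  (isometry_hyperplane n p).isClosedEmbedding.measurableEmbedding

lemma finrank_hyperplane {n : Euc d} (hn : n ≠ 0) :
    Module.finrank ℝ (ℝ ∙ n)ᗮ = d - 1 := by
  have h := (ℝ ∙ n).finrank_add_finrank_orthogonal
  rw [finrank_span_singleton hn, finrank_euclideanSpace_fin] at h
  omega

/-- On a hyperplane, the surface measure is the Lebesgue measure of the hyperplane. -/
lemma map_hyperplane {n : Euc d} (hn : n ≠ 0) (p : Euc d) :
    Measure.map (fun y : (ℝ ∙ n)ᗮ => (y : Euc d) + p) volume =
      (μHE[d - 1] : Measure (Euc d)).restrict (range fun y : (ℝ ∙ n)ᗮ => (y : Euc d) + p) := by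
  rw [← InnerProductSpace.euclideanHausdorffMeasure_eq_volume, finrank_hyperplane hn]
  exact (isometry_hyperplane n p).map_euclideanHausdorffMeasure

lemma setIntegral_hyperplane {n : Euc d} (hn : n ≠ 0) (p : Euc d) {A : Set (Euc d)}
    (hA : MeasurableSet A) (hAp : ∀ x ∈ A, x - p ∈ (ℝ ∙ n)ᗮ) (h : Euc d → ℝ) :
    ∫ x in A, h x ∂(μHE[d - 1] : Measure (Euc d)) =
      ∫ y : (ℝ ∙ n)ᗮ, A.indicator h ((y : Euc d) + p) := by
  have hsub : A ⊆ range fun y : (ℝ ∙ n)ᗮ => (y : Euc d) + p :=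
    fun x hx => ⟨⟨x - p, hAp x hx⟩, by simp⟩
  rw [← (measurableEmbedding_hyperplane n p).integral_map (fun x => A.indicator h x),
    map_hyperplane hn, integral_indicator hA, Measure.restrict_restrict hA,
    inter_eq_left.2 hsub]

lemma measure_hyperplane_lt_top {n : Euc d} (hn : n ≠ 0) (p : Euc d) {A : Set (Euc d)}
    (hA : IsCompact A) (hAp : ∀ x ∈ A, x - p ∈ (ℝ ∙ n)ᗮ) :
    (μHE[d - 1] : Measure (Euc d)) A < ⊤ := by
  have hsub : A ⊆ range fun y : (ℝ ∙ n)ᗮ => (y : Euc d) + p :=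
    fun x hx => ⟨⟨x - p, hAp x hx⟩, by simp⟩
  rw [← inter_eq_left.2 hsub, ← Measure.restrict_apply hA.measurableSet, ← map_hyperplane hn,
    (measurableEmbedding_hyperplane n p).map_apply]
  exact ((isometry_hyperplane n p).isClosedEmbedding.isCompact_preimage hA).measure_lt_top

/-- The zero set of a nonconstant affine function on a hyperplane is a null set. -/
lemma volume_hyperplane_affine_zero {n g : Euc d} (r : ℝ) {z : Euc d} (hz : z ∈ (ℝ ∙ n)ᗮ)
    (hgz : inner ℝ g z ≠ 0) :
    volume {y : (ℝ ∙ n)ᗮ | inner ℝ g (y : Euc d) + r = 0} = 0 := by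
  let f : (ℝ ∙ n)ᗮ →ₗ[ℝ] ℝ := (innerSL ℝ g).toLinearMap ∘ₗ Submodule.subtype _
  have hf : ∀ y, f y = inner ℝ g (y : Euc d) := fun y => rfl
  let s : AffineSubspace ℝ (ℝ ∙ n)ᗮ :=
    (AffineSubspace.mk' (-r) (⊥ : Submodule ℝ ℝ)).comap f.toAffineMap
  have hs : {y : (ℝ ∙ n)ᗮ | inner ℝ g (y : Euc d) + r = 0} = s := by
    ext y
    simp [s, hf]
  rw [hs]
  refine Measure.addHaar_affineSubspace _ s fun htop => ?_
  have h0 : (0 : (ℝ ∙ n)ᗮ) ∈ s := by rw [htop]; trivial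
  have h1 : (⟨z, hz⟩ : (ℝ ∙ n)ᗮ) ∈ s := by rw [htop]; trivial
  rw [← SetLike.mem_coe, ← hs] at h0 h1
  simp only [mem_ofPred_eq, ZeroMemClass.coe_zero, inner_zero_right] at h0 h1
  apply hgz; linarith

lemma isCompact_facet (T : Finset (Euc d)) (a : Euc d) : IsCompact (facet T a) := by
  have h : ((T : Set (Euc d)) \ {a}).Finite := T.finite_toSet.sdiff
  exact h.isCompact_convexHull ℝ

lemma measurableSet_facet (T : Finset (Euc d)) (a : Euc d) : MeasurableSet (facet T a) :=
  (isCompact_facet T a).isClosed.measurableSet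

section

variable {T : Finset (Euc d)} (hT : IsSimplex T) {a b x p : Euc d}
include hT

lemma IsSimplex.sub_mem_of_mem_facet (hd : 1 ≤ d) (ha : a ∈ T) (hx : x ∈ facet T a)
    (hp : p ∈ facet T a) : x - p ∈ (ℝ ∙ outwardNormal T a)ᗮ := by
  rw [Submodule.mem_orthogonal_singleton_iff_inner_right, hT.outwardNormal_eq hd ha,
    inner_neg_left, real_inner_smul_left, inner_baryGrad_sub, ((hT.mem_facet_iff ha).1 hx).1,
    ((hT.mem_facet_iff ha).1 hp).1]
  simp

lemma IsSimplex.facet_nonempty (hd : 1 ≤ d) (a : Euc d) : (facet T a).Nonempty := by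
  obtain ⟨b, hb, hba⟩ := hT.exists_ne hd a
  exact ⟨b, subset_convexHull ℝ _ ⟨hb, hba⟩⟩

lemma IsSimplex.outwardNormal_ne_zero (hd : 1 ≤ d) (ha : a ∈ T) : outwardNormal T a ≠ 0 := by
  rw [← norm_ne_zero_iff, hT.norm_outwardNormal hd ha]; exact one_ne_zero

lemma IsSimplex.isFiniteMeasure_facet (hd : 1 ≤ d) (ha : a ∈ T) :
    IsFiniteMeasure ((μHE[d - 1] : Measure (Euc d)).restrict (facet T a)) := by
  obtain ⟨p, hp⟩ := hT.facet_nonempty hd a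
  refine ⟨?_⟩
  rw [Measure.restrict_apply_univ]
  exact measure_hyperplane_lt_top (hT.outwardNormal_ne_zero hd ha) p (isCompact_facet T a)
    fun x hx => hT.sub_mem_of_mem_facet hd ha hx hp

/-- Continuous functions are integrable over the facets. -/
lemma IsSimplex.integrableOn_facet (hd : 1 ≤ d) (ha : a ∈ T) {h : Euc d → ℝ} (hh : Continuous h) :
    IntegrableOn h (facet T a) (μHE[d - 1] : Measure (Euc d)) := by
  have := hT.isFiniteMeasure_facet hd ha
  obtain ⟨C, hC⟩ := (isCompact_facet T a).exists_bound_of_continuousOn hh.continuousOn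
  exact Integrable.of_bound hh.aestronglyMeasurable C
    ((ae_restrict_iff' (measurableSet_facet T a)).2 (ae_of_all _ hC))

/-- A facet of dimension at least one contains an edge from any of its vertices. -/
lemma IsSimplex.exists_edge (hd : 2 ≤ d) (ha : a ∈ T) (hb : b ∈ T) (hba : b ≠ a) :
    ∃ z ∈ (ℝ ∙ outwardNormal T a)ᗮ, inner ℝ (baryGrad T b) z ≠ 0 := by
  obtain ⟨c, hc⟩ : ((T.erase a).erase b).Nonempty := by
    rw [← Finset.card_pos, Finset.card_erase_of_mem (Finset.mem_erase.2 ⟨hba, hb⟩),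
      Finset.card_erase_of_mem ha, hT.2]
    omega
  simp only [Finset.mem_erase] at hc
  refine ⟨b - c, hT.sub_mem_of_mem_facet (by omega) ha
    (subset_convexHull ℝ _ ⟨hb, hba⟩) (subset_convexHull ℝ _ ⟨hc.2.2, hc.2.1⟩), ?_⟩
  rw [inner_baryGrad_sub, hT.bary_self hb, hT.bary_of_ne hb hc.2.2 hc.1.symm]
  norm_num

/-- Almost every point of the hyperplane of a facet lies off the hyperplanes of the other facets. -/
lemma IsSimplex.ae_hyperplane_bary_ne_zero (hd : 2 ≤ d) (ha : a ∈ T) (p : Euc d) :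
    ∀ᵐ y : (ℝ ∙ outwardNormal T a)ᗮ, ∀ b ∈ T, b ≠ a → bary T b ((y : Euc d) + p) ≠ 0 := by
  rw [Finset.eventually_all]
  intro b hb
  by_cases hba : b = a
  · exact ae_of_all _ fun y h => absurd hba h
  obtain ⟨z, hz, hgz⟩ := hT.exists_edge hd ha hb hba
  have h0 := volume_hyperplane_affine_zero (inner ℝ (baryGrad T b) p + baryConst T b) hz hgz
  refine (measure_eq_zero_iff_ae_notMem.1 h0).mono fun y hy _ h => hy ?_
  simp only [mem_ofPred_eq]
  rw [← h, bary, inner_add_right]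
  ring

/-- Almost every point of a facet belongs to its relative interior. -/
lemma IsSimplex.ae_facet_bary_pos (hd : 2 ≤ d) (ha : a ∈ T) :
    ∀ᵐ x ∂(μHE[d - 1] : Measure (Euc d)).restrict (facet T a),
      bary T a x = 0 ∧ ∀ b ∈ T, b ≠ a → 0 < bary T b x := by
  obtain ⟨p, hp⟩ := hT.facet_nonempty (by omega) a
  have hn := hT.outwardNormal_ne_zero (by omega) ha
  have hsub : facet T a ⊆ range fun y : (ℝ ∙ outwardNormal T a)ᗮ => (y : Euc d) + p :=
    fun x hx => ⟨⟨x - p, hT.sub_mem_of_mem_facet (by omega) ha hx hp⟩, by simp⟩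
  have hm := measurableSet_facet T a
  have h1 : ∀ᵐ x ∂(μHE[d - 1] : Measure (Euc d)).restrict (facet T a),
      ∀ b ∈ T, b ≠ a → bary T b x ≠ 0 := by
    have h2 : ∀ᵐ x ∂Measure.map (fun y : (ℝ ∙ outwardNormal T a)ᗮ => (y : Euc d) + p) volume,
        ∀ b ∈ T, b ≠ a → bary T b x ≠ 0 :=
      (measurableEmbedding_hyperplane _ p).ae_map_iff.2 (hT.ae_hyperplane_bary_ne_zero hd ha p)
    rw [map_hyperplane hn] at h2
    exact ae_mono (Measure.restrict_mono hsub le_rfl) h2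
  filter_upwards [h1, ae_restrict_mem hm] with x hx hxF
  have h3 := (hT.mem_facet_iff ha).1 hxF
  exact ⟨h3.1, fun b hb hba => lt_of_le_of_ne (h3.2 b hb) (hx b hb hba).symm⟩

end

/-! ### A smooth cutoff function on the line -/

/-- A smooth function on `ℝ` which is `0` on `(-∞, 1]`, and `1` on `[2, ∞)`. -/
noncomputable def cutoff (t : ℝ) : ℝ := Real.smoothTransition (t - 1)

lemma contDiff_cutoff : ContDiff ℝ ∞ cutoff :=
  Real.smoothTransition.contDiff.comp (contDiff_id.sub contDiff_const)

lemma continuous_cutoff : Continuous cutoff := contDiff_cutoff.continuous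

lemma cutoff_of_le {t : ℝ} (ht : t ≤ 1) : cutoff t = 0 :=
  Real.smoothTransition.zero_of_nonpos (by linarith)

lemma cutoff_of_ge {t : ℝ} (ht : 2 ≤ t) : cutoff t = 1 :=
  Real.smoothTransition.one_of_one_le (by linarith)

lemma cutoff_nonneg (t : ℝ) : 0 ≤ cutoff t := Real.smoothTransition.nonneg _

lemma cutoff_le_one (t : ℝ) : cutoff t ≤ 1 := Real.smoothTransition.le_one _

lemma continuous_deriv_cutoff : Continuous (deriv cutoff) :=
  contDiff_cutoff.continuous_deriv (by simp)

lemma hasDerivAt_cutoff (t : ℝ) : HasDerivAt cutoff (deriv cutoff t) t :=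
  (contDiff_cutoff.differentiable (by simp) t).hasDerivAt

lemma deriv_cutoff_of_lt {t : ℝ} (ht : t < 1) : deriv cutoff t = 0 := by
  have : cutoff =ᶠ[𝓝 t] fun _ => 0 :=
    (eventually_lt_nhds ht).mono fun s hs => cutoff_of_le hs.le
  rw [this.deriv_eq, deriv_const]

lemma deriv_cutoff_of_gt {t : ℝ} (ht : 2 < t) : deriv cutoff t = 0 := by
  have : cutoff =ᶠ[𝓝 t] fun _ => 1 :=
    (eventually_gt_nhds ht).mono fun s hs => cutoff_of_ge hs.le
  rw [this.deriv_eq, deriv_const]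

lemma integrable_deriv_cutoff : Integrable (deriv cutoff) := by
  refine continuous_deriv_cutoff.integrable_of_hasCompactSupport
    (HasCompactSupport.intro (isCompact_Icc (a := (1 : ℝ)) (b := 2)) fun t ht => ?_)
  rw [mem_Icc, not_and_or, not_le, not_le] at ht
  exact ht.elim deriv_cutoff_of_lt deriv_cutoff_of_gt

lemma integral_deriv_cutoff : ∫ t, deriv cutoff t = 1 := by
  have h := integral_of_hasDerivAt_of_tendsto (f := cutoff) (m := 0) (n := 1) hasDerivAt_cutoff
    integrable_deriv_cutoff
    (tendsto_const_nhds.congr' <| (eventually_le_atBot (1 : ℝ)).mono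
      fun t ht => (cutoff_of_le ht).symm)
    (tendsto_const_nhds.congr' <| (eventually_ge_atTop (2 : ℝ)).mono
      fun t ht => (cutoff_of_ge ht).symm)
  simpa using h

lemma cutoff_div_of_nonpos {s ε : ℝ} (hε : 0 < ε) (hs : s ≤ 0) : cutoff (s / ε) = 0 :=
  cutoff_of_le ((div_nonpos_of_nonpos_of_nonneg hs hε.le).trans zero_le_one)

lemma deriv_cutoff_div_of_nonpos {s ε : ℝ} (hε : 0 < ε) (hs : s ≤ 0) :
    deriv cutoff (s / ε) = 0 :=
  deriv_cutoff_of_lt ((div_nonpos_of_nonpos_of_nonneg hs hε.le).trans_lt zero_lt_one)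

/-- If `s ε → L > 0` as `ε → 0+`, then `cutoff (s ε / ε) = 1` eventually. -/
lemma eventually_cutoff_div_eq_one {s : ℝ → ℝ} {L : ℝ} (hs : Tendsto s (𝓝[>] 0) (𝓝 L))
    (hL : 0 < L) : ∀ᶠ ε in 𝓝[>] (0 : ℝ), cutoff (s ε / ε) = 1 := by
  have h1 : Tendsto (fun ε => s ε / ε) (𝓝[>] 0) atTop := by
    simp only [div_eq_mul_inv]
    exact hs.pos_mul_atTop hL tendsto_inv_nhdsGT_zero
  exact (h1.eventually_ge_atTop 2).mono fun ε h => cutoff_of_ge h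

/-- If `s ε → L < 0` as `ε → 0+`, then `cutoff (s ε / ε) = 0` eventually. -/
lemma eventually_cutoff_div_eq_zero {s : ℝ → ℝ} {L : ℝ} (hs : Tendsto s (𝓝[>] 0) (𝓝 L))
    (hL : L < 0) : ∀ᶠ ε in 𝓝[>] (0 : ℝ), cutoff (s ε / ε) = 0 := by
  filter_upwards [hs.eventually (eventually_lt_nhds hL), self_mem_nhdsWithin] with ε h1 h2
  exact cutoff_div_of_nonpos h2 h1.le

/-! ### The divergence theorem on a simplex -/

lemma continuous_strip (T : Finset (Euc d)) (a : Euc d) {h : Euc d → ℝ} (hh : Continuous h)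
    (ε : ℝ) :
    Continuous fun x => h x * (deriv cutoff (bary T a x / ε) / ε *
      ∏ b ∈ T.erase a, cutoff (bary T b x / ε)) :=
  hh.mul (((continuous_deriv_cutoff.comp ((continuous_bary T a).div_const ε)).div_const ε).mul
    (continuous_finsetProd _ fun b _ =>
      continuous_cutoff.comp ((continuous_bary T b).div_const ε)))

section

variable {T : Finset (Euc d)} (hT : IsSimplex T) {a b x p : Euc d}
include hT

lemma IsSimplex.prod_cutoff_erase_eq_zero {ε : ℝ} (hε : 0 < ε) (hxa : 0 ≤ bary T a x)
    (hx : x ∉ convexHull ℝ (T : Set (Euc d))) :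
    ∏ b ∈ T.erase a, cutoff (bary T b x / ε) = 0 := by
  rw [hT.mem_convexHull_iff] at hx
  push Not at hx
  obtain ⟨b, hb, hbx⟩ := hx
  have hba : b ≠ a := by rintro rfl; linarith
  exact Finset.prod_eq_zero (Finset.mem_erase.2 ⟨hba, hb⟩) (cutoff_div_of_nonpos hε hbx.le)

lemma IsSimplex.integrable_strip {h : Euc d → ℝ} (hh : Continuous h) {ε : ℝ} (hε : 0 < ε) :
    Integrable fun x => h x * (deriv cutoff (bary T a x / ε) / ε *
      ∏ b ∈ T.erase a, cutoff (bary T b x / ε)) := by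
  refine (continuous_strip T a hh ε).integrable_of_hasCompactSupport
    (HasCompactSupport.intro (isCompact_convexHull_finset T) fun x hx => ?_)
  rcases le_or_gt (bary T a x) 0 with h0 | h0
  · rw [deriv_cutoff_div_of_nonpos hε h0]; simp
  · rw [hT.prod_cutoff_erase_eq_zero hε h0.le hx]; simp

/-- The part of the derivative of the cutoff `∏ b ∈ T, cutoff (bary T b x / ε)` that comes from the
facet opposite to `a` concentrates on that facet as `ε → 0+`. -/
lemma IsSimplex.tendsto_strip (hd : 2 ≤ d) (ha : a ∈ T) {h : Euc d → ℝ} (hh : Continuous h) :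
    Tendsto (fun ε : ℝ => ∫ x, h x * (deriv cutoff (bary T a x / ε) / ε *
        ∏ b ∈ T.erase a, cutoff (bary T b x / ε))) (𝓝[>] 0)
      (𝓝 (‖baryGrad T a‖⁻¹ * ∫ x in facet T a, h x ∂(μHE[d - 1] : Measure (Euc d)))) := by
  have hd1 : 1 ≤ d := by omega
  obtain ⟨p, hp⟩ := hT.facet_nonempty hd1 a
  have hp0 : bary T a p = 0 := ((hT.mem_facet_iff ha).1 hp).1
  have hg : 0 < ‖baryGrad T a‖ := norm_pos_iff.2 (hT.baryGrad_ne_zero hd1 ha)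
  set G := ‖baryGrad T a‖ with hG
  set n := outwardNormal T a with hn
  have hn1 : ‖n‖ = 1 := hT.norm_outwardNormal hd1 ha
  have hn0 : n ≠ 0 := hT.outwardNormal_ne_zero hd1 ha
  have hgn : inner ℝ (baryGrad T a) n = -G := hT.inner_baryGrad_outwardNormal hd1 ha
  have hgy : ∀ y : (ℝ ∙ n)ᗮ, inner ℝ (baryGrad T a) (y : Euc d) = 0 := by
    intro y
    have h1 : inner ℝ (-(G⁻¹ • baryGrad T a)) (y : Euc d) = 0 := by
      rw [hG, ← hT.outwardNormal_eq hd1 ha]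
      exact (Submodule.mem_orthogonal_singleton_iff_inner_right).1 y.2
    rw [inner_neg_left, real_inner_smul_left, neg_eq_zero, mul_eq_zero] at h1
    exact h1.resolve_left (inv_ne_zero hg.ne')
  have hbary : ∀ (s : ℝ) (y : (ℝ ∙ n)ᗮ), bary T a (s • n + (y : Euc d) + p) = -(G * s) := by
    intro s y
    rw [add_comm, bary_add, hp0, inner_add_right, inner_smul_right, hgn, hgy]
    ring
  obtain ⟨M, hM⟩ := (isCompact_convexHull_finset T).exists_bound_of_continuousOn hh.continuousOn
  obtain ⟨R, hR⟩ := (isCompact_convexHull_finset T).exists_bound_of_continuousOn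
    (f := fun x => x - p) (by fun_prop)
  -- A point of the simplex has bounded projection to the hyperplane of the facet.
  have hproj : ∀ (s : ℝ) (y : (ℝ ∙ n)ᗮ), s • n + (y : Euc d) + p ∈ convexHull ℝ (T : Set (Euc d)) →
      ‖y‖ ≤ R := by
    intro s y hy
    have h1 := hR _ hy
    rw [add_sub_cancel_right] at h1
    refine le_trans ?_ h1
    have h2 : inner ℝ (s • n) (y : Euc d) = 0 := by
      rw [real_inner_smul_left, (Submodule.mem_orthogonal_singleton_iff_inner_right).1 y.2,
        mul_zero]
    have h3 := norm_add_sq_eq_norm_sq_add_norm_sq_real h2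
    rw [Submodule.coe_norm]
    nlinarith [norm_nonneg (s • n), norm_nonneg (y : Euc d), norm_nonneg (s • n + (y : Euc d))]
  let f : ℝ → Euc d → ℝ := fun ε x => h x * (deriv cutoff (bary T a x / ε) / ε *
        ∏ b ∈ T.erase a, cutoff (bary T b x / ε))
  have hfc : ∀ ε, Continuous (f ε) := continuous_strip T a hh
  let X : ℝ → ℝ × (ℝ ∙ n)ᗮ → Euc d := fun ε q => (-(ε / G) * q.1) • n + (q.2 : Euc d) + p
  have hXc : ∀ ε, Continuous (X ε) := fun ε => by simp only [X]; fun_prop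
  have hXb : ∀ ε q, bary T a (X ε q) = ε * q.1 := by
    intro ε q
    rw [hbary]; field_simp
  let F : ℝ → ℝ × (ℝ ∙ n)ᗮ → ℝ := fun ε q => G⁻¹ * (deriv cutoff q.1 *
    (h (X ε q) * ∏ b ∈ T.erase a, cutoff (bary T b (X ε q) / ε)))
  have hFc : ∀ ε, Continuous (F ε) := fun ε =>
    continuous_const.mul ((continuous_deriv_cutoff.comp continuous_fst).mul
      ((hh.comp (hXc ε)).mul (continuous_finsetProd _ fun b _ =>
        continuous_cutoff.comp (((continuous_bary T b).comp (hXc ε)).div_const ε))))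
  let bound : ℝ × (ℝ ∙ n)ᗮ → ℝ := fun q =>
    G⁻¹ * (|deriv cutoff q.1| * (Metric.closedBall (0 : (ℝ ∙ n)ᗮ) R).indicator (fun _ => M) q.2)
  have hbound : Integrable bound := by
    refine Integrable.const_mul ?_ _
    refine Integrable.mul_prod integrable_deriv_cutoff.abs ?_
    rw [integrable_indicator_iff Metric.isClosed_closedBall.measurableSet]
    exact integrableOn_const (isCompact_closedBall _ _).measure_lt_top.ne
  have hFb : ∀ ε > 0, ∀ q, ‖F ε q‖ ≤ bound q := by
    intro ε hε q
    simp only [F, bound, norm_mul, norm_inv, Real.norm_eq_abs, abs_of_pos hg]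
    refine mul_le_mul_of_nonneg_left ?_ (inv_nonneg.2 hg.le)
    by_cases hq : q.1 < 1
    · rw [deriv_cutoff_of_lt hq]; simp
    refine mul_le_mul_of_nonneg_left ?_ (abs_nonneg _)
    by_cases hX : X ε q ∈ convexHull ℝ (T : Set (Euc d))
    · rw [indicator_of_mem (by simpa using hproj _ _ hX)]
      refine le_trans (mul_le_of_le_one_right (abs_nonneg _) ?_) (hM _ hX)
      rw [Finset.abs_prod]
      refine Finset.prod_le_one (fun _ _ => abs_nonneg _) fun b _ => ?_
      rw [abs_of_nonneg (cutoff_nonneg _)]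
      exact cutoff_le_one _
    · rw [hT.prod_cutoff_erase_eq_zero hε _ hX]
      · simp only [abs_zero, mul_zero]
        refine indicator_nonneg (fun _ _ => ?_) _
        exact (norm_nonneg _).trans (hM p (convexHull_mono sdiff_subset hp))
      · rw [hXb]; exact mul_nonneg hε.le (by linarith)
  have hFi : ∀ ε > 0, Integrable (F ε) := fun ε hε =>
    hbound.mono' (hFc ε).aestronglyMeasurable (ae_of_all _ (hFb ε hε))
  -- Slicing along `n` and rescaling the coordinate along `n` by `ε`.
  have hchange : ∀ ε > 0, ∫ x, f ε x = ∫ q, F ε q := by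
    intro ε hε
    have hmp := measurePreserving_slice hn1 p
    rw [← hmp.map_eq, integral_map hmp.aemeasurable (hfc ε).aestronglyMeasurable,
      Measure.volume_eq_prod, integral_prod_symm,
      integral_prod_symm _ (hFi ε hε)]
    · refine integral_congr_ae (ae_of_all _ fun y => ?_)
      simp only
      have hc := Measure.integral_comp_mul_left
        (fun s : ℝ => f ε (s • n + (y : Euc d) + p)) (-(ε / G))
      have hεG : 0 < ε / G := div_pos hε hg
      rw [abs_inv, abs_neg, abs_of_pos hεG, smul_eq_mul, eq_inv_mul_iff_mul_eq₀ hεG.ne'] at hc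
      rw [← hc, ← integral_const_mul]
      refine integral_congr_ae (ae_of_all _ fun r => ?_)
      have h1 : bary T a ((-(ε / G) * r) • n + (y : Euc d) + p) / ε = r := by
        rw [hbary]; field_simp
      simp only [f, F, X, h1]
      field_simp
    · have := hmp.integrable_comp (g := f ε) (hfc ε).aestronglyMeasurable
      exact this.2 (hT.integrable_strip hh hε)
  have hlim : ∫ q : ℝ × (ℝ ∙ n)ᗮ, G⁻¹ * (deriv cutoff q.1 * (facet T a).indicator h (q.2 + p)) =
      G⁻¹ * ∫ x in facet T a, h x ∂(μHE[d - 1] : Measure (Euc d)) := by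
    rw [integral_const_mul, Measure.volume_eq_prod,
      integral_prod_mul (deriv cutoff) fun y : (ℝ ∙ n)ᗮ => (facet T a).indicator h (y + p),
      integral_deriv_cutoff, one_mul, setIntegral_hyperplane hn0 p (measurableSet_facet T a)
      fun x hx => hT.sub_mem_of_mem_facet hd1 ha hx hp]
  rw [← hlim]
  have hev : ∀ᶠ ε : ℝ in 𝓝[>] 0, 0 < ε := self_mem_nhdsWithin
  refine Tendsto.congr' (hev.mono fun ε hε => (hchange ε hε).symm) ?_
  refine tendsto_integral_filter_of_dominated_convergence bound
    (Eventually.of_forall fun ε => (hFc ε).aestronglyMeasurable)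
    (hev.mono fun ε hε => ae_of_all _ (hFb ε hε)) hbound ?_
  have hae := (Measure.quasiMeasurePreserving_snd (μ := (volume : Measure ℝ))
    (ν := (volume : Measure (ℝ ∙ n)ᗮ))).ae (hT.ae_hyperplane_bary_ne_zero hd ha p)
  rw [Measure.volume_eq_prod]
  refine hae.mono fun q hq => ?_
  refine (Tendsto.const_mul _ ?_).const_mul _
  have hXt : Tendsto (fun ε => X ε q) (𝓝[>] 0) (𝓝 ((q.2 : Euc d) + p)) := by
    have : Continuous fun ε => X ε q := by simp only [X]; fun_prop
    have := this.tendsto 0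
    simp only [X, zero_div, neg_zero, zero_mul, zero_smul, zero_add] at this
    exact this.mono_left nhdsWithin_le_nhds
  have hbt : ∀ b, Tendsto (fun ε => bary T b (X ε q)) (𝓝[>] 0) (𝓝 (bary T b ((q.2 : Euc d) + p))) :=
    fun b => ((continuous_bary T b).tendsto _).comp hXt
  have hya : bary T a ((q.2 : Euc d) + p) = 0 := by
    have := hbary 0 q.2
    simpa using this
  by_cases hF : (q.2 : Euc d) + p ∈ facet T a
  · rw [indicator_of_mem hF]
    have h1 : ∀ᶠ ε in 𝓝[>] (0 : ℝ), ∏ b ∈ T.erase a, cutoff (bary T b (X ε q) / ε) = 1 := by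
      have : ∀ᶠ ε in 𝓝[>] (0 : ℝ), ∀ b ∈ T.erase a, cutoff (bary T b (X ε q) / ε) = 1 := by
        rw [Finset.eventually_all]
        intro b hb
        rw [Finset.mem_erase] at hb
        exact eventually_cutoff_div_eq_one (hbt b)
          (lt_of_le_of_ne (((hT.mem_facet_iff ha).1 hF).2 b hb.2) (hq b hb.2 hb.1).symm)
      exact this.mono fun ε hε => Finset.prod_eq_one hε
    refine Tendsto.congr' (h1.mono fun ε hε => ?_) ((hh.tendsto _).comp hXt)
    simp only [Function.comp]
    rw [hε, mul_one]
  · rw [indicator_of_notMem hF]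
    have hex : ∃ b ∈ T, bary T b ((q.2 : Euc d) + p) < 0 := by
      by_contra! hcon
      exact hF ((hT.mem_facet_iff ha).2 ⟨hya, hcon⟩)
    obtain ⟨b, hb, hb0⟩ := hex
    have hba : b ≠ a := by rintro rfl; linarith
    refine tendsto_const_nhds.congr' ?_
    refine (eventually_cutoff_div_eq_zero (hbt b) hb0).mono fun ε hε => ?_
    have h0 : ∏ b ∈ T.erase a, cutoff (bary T b (X ε q) / ε) = 0 :=
      Finset.prod_eq_zero (i := b) (Finset.mem_erase.2 ⟨hba, hb⟩) hε
    simp only [h0, mul_zero]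

/-- **Divergence theorem** on a simplex for the product of a continuous field `β`, whose
distributional divergence vanishes in the interior of the simplex, and a smooth function. -/
theorem IsSimplex.integral_fderiv_eq_sum_facetIntegral (hd : 2 ≤ d) {β : Euc d → Euc d}
    (hβ : Continuous β)
    (hdiv : ∀ ψ : Euc d → ℝ, ContDiff ℝ ∞ ψ → HasCompactSupport ψ → tsupport ψ ⊆ openCell T →
      ∫ x, fderiv ℝ ψ x (β x) = 0)
    {φ : Euc d → ℝ} (hφ : ContDiff ℝ ∞ φ) :
    ∫ x in openCell T, fderiv ℝ φ x (β x) =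
      ∑ a ∈ T, facetIntegral T a fun x => inner ℝ (β x) (outwardNormal T a) * φ x := by
  have hd1 : 1 ≤ d := by omega
  let χ : ℝ → Euc d → ℝ := fun ε x => ∏ b ∈ T, cutoff (bary T b x / ε)
  have hχs : ∀ ε, ContDiff ℝ ∞ (χ ε) := fun ε =>
    contDiff_prod fun b _ => contDiff_cutoff.comp ((contDiff_bary T b).div_const ε)
  have hev : ∀ᶠ ε : ℝ in 𝓝[>] 0, 0 < ε := self_mem_nhdsWithin
  have hχ0 : ∀ ε > 0, ∀ x, x ∉ openCell T → χ ε x = 0 := by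
    intro ε hε x hx
    rw [hT.mem_openCell_iff hd1] at hx
    push Not at hx
    obtain ⟨b, hb, hbx⟩ := hx
    exact Finset.prod_eq_zero hb (cutoff_div_of_nonpos hε hbx)
  have hχT : ∀ ε > 0, tsupport (χ ε) ⊆ openCell T := by
    intro ε hε
    have hc : IsClosed (⋂ b ∈ T, {x | ε ≤ bary T b x}) :=
      isClosed_biInter fun b _ => isClosed_le continuous_const (continuous_bary T b)
    refine (closure_minimal ?_ hc).trans ?_
    · intro x hx
      simp only [mem_iInter, mem_ofPred_eq]
      intro b hb
      by_contra! hlt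
      refine hx (Finset.prod_eq_zero hb (cutoff_of_le ?_))
      rw [div_le_one hε]; exact hlt.le
    · intro x hx
      simp only [mem_iInter, mem_ofPred_eq] at hx
      exact (hT.mem_openCell_iff hd1).2 fun b hb => hε.trans_le (hx b hb)
  have hχc : ∀ ε > 0, HasCompactSupport (χ ε) := fun ε hε =>
    (isCompact_convexHull_finset T).of_isClosed_subset (isClosed_tsupport _)
      ((hχT ε hε).trans interior_subset)
  have hφ' : Continuous fun x => fderiv ℝ φ x (β x) :=
    (hφ.continuous_fderiv (by simp)).clm_apply hβ
  have hha : ∀ a, Continuous fun x => φ x * inner ℝ (baryGrad T a) (β x) := fun a =>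
    hφ.continuous.mul (continuous_const.inner hβ)
  have hder : ∀ ε x, fderiv ℝ (fun x => χ ε x * φ x) x (β x) = χ ε x * fderiv ℝ φ x (β x) +
      ∑ a ∈ T, (φ x * inner ℝ (baryGrad T a) (β x)) * (deriv cutoff (bary T a x / ε) / ε *
        ∏ b ∈ T.erase a, cutoff (bary T b x / ε)) := by
    intro ε x
    have h1 : ∀ b ∈ T, HasFDerivAt (fun x => cutoff (bary T b x / ε))
        (deriv cutoff (bary T b x / ε) • (ε⁻¹ • innerSL ℝ (baryGrad T b))) x := by
      intro b _
      refine (hasDerivAt_cutoff _).comp_hasFDerivAt x ?_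
      simpa only [div_eq_mul_inv] using (hasFDerivAt_bary T b x).mul_const ε⁻¹
    have h2 := (HasFDerivAt.finsetProd h1).mul
      (hφ.differentiable (by simp) x).hasFDerivAt
    rw [show fderiv ℝ (fun x => χ ε x * φ x) x = _ from h2.fderiv]
    simp only [add_apply, smul_apply,
      sum_apply, smul_eq_mul, innerSL_apply_apply, Finset.mul_sum]
    refine congrArg₂ _ rfl (Finset.sum_congr rfl fun a _ => ?_)
    ring
  have hAi : ∀ ε > 0, Integrable fun x => χ ε x * fderiv ℝ φ x (β x) := fun ε hε =>
    ((hχs ε).continuous.mul hφ').integrable_of_hasCompactSupport ((hχc ε hε).mul_right)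
  have hzero : ∀ ε > 0, (∫ x, χ ε x * fderiv ℝ φ x (β x)) + ∑ a ∈ T,
      ∫ x, (φ x * inner ℝ (baryGrad T a) (β x)) * (deriv cutoff (bary T a x / ε) / ε *
        ∏ b ∈ T.erase a, cutoff (bary T b x / ε)) = 0 := by
    intro ε hε
    rw [← integral_finsetSum _ fun a _ => hT.integrable_strip (hha a) hε,
      ← integral_add (hAi ε hε) (integrable_finsetSum _ fun a _ => hT.integrable_strip (hha a) hε)]
    simp only [← hder]
    exact hdiv _ ((hχs ε).mul hφ) ((hχc ε hε).mul_right)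
      ((tsupport_mul_subset_left).trans (hχT ε hε))
  have hlim1 : Tendsto (fun ε => ∫ x, χ ε x * fderiv ℝ φ x (β x)) (𝓝[>] 0)
      (𝓝 (∫ x in openCell T, fderiv ℝ φ x (β x))) := by
    have hm : MeasurableSet (openCell T) := isOpen_interior.measurableSet
    rw [← integral_indicator hm]
    refine tendsto_integral_filter_of_dominated_convergence
      ((openCell T).indicator fun x => ‖fderiv ℝ φ x (β x)‖)
      (Eventually.of_forall fun ε => ((hχs ε).continuous.mul hφ').aestronglyMeasurable)
      (hev.mono fun ε hε => ae_of_all _ fun x => ?_) ?_ (ae_of_all _ fun x => ?_)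
    · by_cases hx : x ∈ openCell T
      · rw [indicator_of_mem hx, norm_mul]
        refine mul_le_of_le_one_left (norm_nonneg _) ?_
        rw [Real.norm_eq_abs, Finset.abs_prod]
        refine Finset.prod_le_one (fun _ _ => abs_nonneg _) fun b _ => ?_
        rw [abs_of_nonneg (cutoff_nonneg _)]
        exact cutoff_le_one _
      · rw [indicator_of_notMem hx, hχ0 ε hε x hx]; simp
    · rw [integrable_indicator_iff hm]
      exact ((hφ'.norm.continuousOn.integrableOn_compact
        (isCompact_convexHull_finset T)).mono_set interior_subset)
    · by_cases hx : x ∈ openCell T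
      · rw [indicator_of_mem hx]
        have h1 : ∀ᶠ ε in 𝓝[>] (0 : ℝ), χ ε x = 1 := by
          have : ∀ᶠ ε in 𝓝[>] (0 : ℝ), ∀ b ∈ T, cutoff (bary T b x / ε) = 1 := by
            rw [Finset.eventually_all]
            intro b hb
            exact eventually_cutoff_div_eq_one tendsto_const_nhds
              ((hT.mem_openCell_iff hd1).1 hx b hb)
          exact this.mono fun ε hε => Finset.prod_eq_one hε
        exact tendsto_const_nhds.congr' (h1.mono fun ε hε => by simp only [hε, one_mul])
      · rw [indicator_of_notMem hx]
        exact tendsto_const_nhds.congr'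
          (hev.mono fun ε hε => by simp only [hχ0 ε hε x hx, zero_mul])
  have hlim2 := hlim1.add (tendsto_finsetSum T fun a ha => hT.tendsto_strip hd ha (hha a))
  have h0 := tendsto_nhds_unique hlim2
    (tendsto_const_nhds.congr' (hev.mono fun ε hε => (hzero ε hε).symm))
  rw [eq_neg_of_add_eq_zero_left h0, ← Finset.sum_neg_distrib]
  refine Finset.sum_congr rfl fun a ha => ?_
  rw [facetIntegral, ← neg_mul, ← integral_const_mul]
  refine integral_congr_ae (ae_of_all _ fun x => ?_)
  simp only
  rw [hT.outwardNormal_eq hd1 ha, inner_neg_right, inner_smul_right, real_inner_comm]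
  ring

end

/-! ### Relative interiors of facets -/

/-- The relative interior of the facet of `T` opposite to `a`, in barycentric coordinates. -/
def facetInterior (T : Finset (Euc d)) (a : Euc d) : Set (Euc d) :=
  {x | bary T a x = 0 ∧ ∀ b ∈ T, b ≠ a → 0 < bary T b x}

section

variable {T : Finset (Euc d)} (hT : IsSimplex T) {a b x y p : Euc d}
include hT

lemma IsSimplex.facetInterior_subset (ha : a ∈ T) : facetInterior T a ⊆ facet T a := by
  intro x hx
  refine (hT.mem_facet_iff ha).2 ⟨hx.1, fun b hb => ?_⟩
  by_cases hba : b = a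
  · rw [hba, hx.1]
  · exact (hx.2 b hb hba).le

/-- Moving from a relatively interior point of a facet against the outward normal leads into the
simplex. -/
lemma IsSimplex.eventually_mem_openCell (hd : 1 ≤ d) (ha : a ∈ T) (hx : x ∈ facetInterior T a)
    {c : ℝ} (hc : 0 < c) :
    ∀ᶠ ε in 𝓝[>] (0 : ℝ), x - ε • (c • outwardNormal T a) ∈ openCell T := by
  have hG : 0 < ‖baryGrad T a‖ := norm_pos_iff.2 (hT.baryGrad_ne_zero hd ha)
  have h1 : ∀ᶠ ε in 𝓝[>] (0 : ℝ), ∀ b ∈ T, 0 < bary T b (x - ε • (c • outwardNormal T a)) := by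
    rw [Finset.eventually_all]
    intro b hb
    by_cases hba : b = a
    · filter_upwards [self_mem_nhdsWithin] with ε hε
      rw [hba, sub_eq_add_neg, ← smul_neg, bary_add_smul, hx.1, inner_neg_right, inner_smul_right,
        hT.inner_baryGrad_outwardNormal hd ha]
      have := mul_pos (mul_pos (mem_Ioi.1 hε) hc) hG
      linarith
    · have h2 : Continuous fun ε : ℝ => bary T b (x - ε • (c • outwardNormal T a)) :=
        (continuous_bary T b).comp (by fun_prop)
      have h3 := h2.tendsto 0
      simp only [zero_smul, sub_zero] at h3
      exact (h3.eventually (eventually_gt_nhds (hx.2 b hb hba))).filter_mono nhdsWithin_le_nhds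
  exact h1.mono fun ε hε => (hT.mem_openCell_iff hd).2 hε

lemma IsSimplex.add_smul_notMem (hd : 1 ≤ d) (ha : a ∈ T) (hx : x ∈ facetInterior T a)
    {ε : ℝ} (hε : 0 < ε) : x + ε • outwardNormal T a ∉ convexHull ℝ (T : Set (Euc d)) := by
  intro h
  have h1 := hT.mem_convexHull_iff.1 h a ha
  rw [bary_add_smul, hx.1, hT.inner_baryGrad_outwardNormal hd ha] at h1
  have hG : 0 < ‖baryGrad T a‖ := norm_pos_iff.2 (hT.baryGrad_ne_zero hd ha)
  nlinarith

/-- The barycenter of a facet lies in its relative interior. -/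
lemma IsSimplex.barycenter_mem (hd : 1 ≤ d) (ha : a ∈ T) :
    ∑ i ∈ T.erase a, (d : ℝ)⁻¹ • i ∈ facetInterior T a := by
  have hd' : (0 : ℝ) < d := by exact_mod_cast hd
  have hcard : (T.erase a).card = d := by rw [Finset.card_erase_of_mem ha, hT.2]; rfl
  have key : ∀ b ∈ T, bary T b (∑ i ∈ T.erase a, (d : ℝ)⁻¹ • i) =
      ∑ i ∈ T.erase a, (d : ℝ)⁻¹ * if b = i then 1 else 0 := by
    intro b hb
    have h1 : ∀ i ∈ T.erase a, (d : ℝ)⁻¹ * (if b = i then 1 else 0) =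
        (d : ℝ)⁻¹ * inner ℝ (baryGrad T b) i + (d : ℝ)⁻¹ * baryConst T b := by
      intro i hi
      rw [← hT.bary_vertex hb (Finset.mem_of_mem_erase hi), bary]
      ring
    rw [Finset.sum_congr rfl h1, Finset.sum_add_distrib, Finset.sum_const, hcard, bary, inner_sum]
    simp only [inner_smul_right, nsmul_eq_mul]
    field_simp
  refine ⟨?_, fun b hb hba => ?_⟩
  · rw [key a ha]
    refine Finset.sum_eq_zero fun i hi => ?_
    rw [if_neg (Finset.ne_of_mem_erase hi).symm, mul_zero]
  · rw [key b hb, Finset.sum_mul_boole, if_pos (Finset.mem_erase.2 ⟨hba, hb⟩)]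
    positivity

lemma IsSimplex.facet_subset_closure (hd : 1 ≤ d) (ha : a ∈ T) :
    facet T a ⊆ closure (facetInterior T a) := by
  intro y hy
  set z := ∑ i ∈ T.erase a, (d : ℝ)⁻¹ • i
  have hz := hT.barycenter_mem hd ha
  have hy' := (hT.mem_facet_iff ha).1 hy
  have hc : Continuous fun t : ℝ => (1 - t) • y + t • z := by fun_prop
  have ht := (hc.tendsto 0).mono_left (nhdsWithin_le_nhds (s := Ioi 0))
  simp only [sub_zero, one_smul, zero_smul, add_zero] at ht
  refine mem_closure_of_tendsto ht ?_
  have h1 : ∀ᶠ t : ℝ in 𝓝[>] 0, t < 1 := (eventually_lt_nhds zero_lt_one).filter_mono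
    nhdsWithin_le_nhds
  filter_upwards [self_mem_nhdsWithin, h1] with t ht0 ht1
  refine ⟨?_, fun b hb hba => ?_⟩
  · rw [bary_combination T a _ _ (by ring), hy'.1, hz.1]; simp
  · rw [bary_combination T b _ _ (by ring)]
    have h2 := mul_pos (mem_Ioi.1 ht0) (hz.2 b hb hba)
    have h3 := mul_nonneg (sub_nonneg.2 ht1.le) (hy'.2 b hb)
    linarith

/-- Two simplices with a common facet have the same or opposite normals there. -/
lemma IsSimplex.outwardNormal_eq_or_eq_neg {T' : Finset (Euc d)} (hT' : IsSimplex T') {a' : Euc d}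
    (hd : 1 ≤ d) (ha : a ∈ T) (ha' : a' ∈ T') (h : T'.erase a' = T.erase a) :
    outwardNormal T' a' = outwardNormal T a ∨ outwardNormal T' a' = -outwardNormal T a := by
  have hset : (T' : Set (Euc d)) \ {a'} = (T : Set (Euc d)) \ {a} := by
    rw [← Finset.coe_erase, ← Finset.coe_erase, h]
  have h1 : (ℝ ∙ baryGrad T' a')ᗮ = (ℝ ∙ baryGrad T a)ᗮ := by
    rw [← hT.vectorSpan_facet hd ha, ← hT'.vectorSpan_facet hd ha', hset]
  have h2 : ℝ ∙ baryGrad T' a' = ℝ ∙ baryGrad T a := by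
    rw [← Submodule.orthogonal_orthogonal (ℝ ∙ baryGrad T' a'), h1,
      Submodule.orthogonal_orthogonal]
  have h3 : baryGrad T' a' ∈ ℝ ∙ baryGrad T a := h2 ▸ Submodule.mem_span_singleton_self _
  obtain ⟨t, ht⟩ := Submodule.mem_span_singleton.1 h3
  have hG : 0 < ‖baryGrad T a‖ := norm_pos_iff.2 (hT.baryGrad_ne_zero hd ha)
  have h4 : outwardNormal T' a' =
      (‖baryGrad T' a'‖⁻¹ * t * ‖baryGrad T a‖) • outwardNormal T a := by
    rw [hT.outwardNormal_eq hd ha, hT'.outwardNormal_eq hd ha', smul_neg, smul_smul, ← ht,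
      smul_smul]
    congr 2
    field_simp
  set s := ‖baryGrad T' a'‖⁻¹ * t * ‖baryGrad T a‖
  have h5 : |s| = 1 := by
    have := congrArg norm h4
    rwa [norm_smul, hT.norm_outwardNormal hd ha, hT'.norm_outwardNormal hd ha', mul_one,
      Real.norm_eq_abs, eq_comm] at this
  rcases eq_or_eq_neg_of_abs_eq h5 with h6 | h6
  · left; rw [h4, h6, one_smul]
  · right; rw [h4, h6, neg_one_smul]

end

/-! ### Domains and their triangulations -/

/-- A Lipschitz domain lies on one side of its boundary. -/
lemma HasLipschitzBoundary.interior_closure {Ω : Set (Euc d)} (hΩ : HasLipschitzBoundary Ω)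
    (hΩo : IsOpen Ω) : interior (closure Ω) = Ω := by
  refine Subset.antisymm (fun x hx => ?_) (interior_maximal subset_closure hΩo)
  by_contra hxΩ
  have hxf : x ∈ frontier Ω := by
    rw [frontier, hΩo.interior_eq]; exact ⟨interior_subset hx, hxΩ⟩
  obtain ⟨e, he, r, hr, L, g, hg, hiff⟩ := hΩ x hxf
  let s : Euc d → ℝ := fun z => inner ℝ e z - g (z - inner ℝ e z • e)
  have hs : Continuous s := by
    have h1 : Continuous fun z : Euc d => inner ℝ e z := continuous_const.inner continuous_id
    exact h1.sub (hg.continuous.comp (continuous_id.sub (h1.smul continuous_const)))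
  have hsx : 0 ≤ s x := by
    by_contra! hlt
    exact hxΩ ((hiff x (Metric.mem_ball_self hr)).2 (sub_neg.1 hlt))
  have hmove : ∀ t : ℝ, s (x + t • e) = s x + t := by
    intro t
    have h1 : inner ℝ e (x + t • e) = inner ℝ e x + t := by
      rw [inner_add_right, inner_smul_right, real_inner_self_eq_norm_sq, he]; ring
    have h2 : x + t • e - (inner ℝ e x + t) • e = x - inner ℝ e x • e := by
      rw [add_smul]; abel
    simp only [s, h1, h2]; ring
  have hc : Continuous fun t : ℝ => x + t • e := by fun_prop
  have ht := (hc.tendsto 0).mono_left (nhdsWithin_le_nhds (s := Ioi 0))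
  simp only [zero_smul, add_zero] at ht
  obtain ⟨t, ⟨ht1, ht2⟩, ht0⟩ := (((ht.eventually (mem_interior_iff_mem_nhds.1 hx)).and
    (ht.eventually (Metric.ball_mem_nhds x hr))).and self_mem_nhdsWithin).exists
  have hpos : 0 < s (x + t • e) := by rw [hmove]; linarith [show (0 : ℝ) < t from ht0]
  have ho : IsOpen ({z | 0 < s z} ∩ Metric.ball x r) :=
    (isOpen_lt continuous_const hs).inter Metric.isOpen_ball
  obtain ⟨z, ⟨hz1, hz2⟩, hz3⟩ := mem_closure_iff.1 ht1 _ ho ⟨hpos, ht2⟩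
  have h3 := (hiff z hz2).1 hz3
  have h4 : 0 < s z := hz1
  simp only [s] at h4
  linarith

namespace Triangulation

variable {Ω : Set (Euc d)} (𝒯 : Triangulation Ω) {T T' : Finset (Euc d)} {a a' b x : Euc d}

lemma mem_elements_iff : T ∈ 𝒯.elements ↔ T ∈ 𝒯.complex.faces ∧ T.card = d + 1 := by
  simp [elements]

variable {𝒯}

lemma isSimplex (hT : T ∈ 𝒯.elements) : IsSimplex T :=
  ⟨𝒯.complex.indep (𝒯.mem_elements_iff.1 hT).1, (𝒯.mem_elements_iff.1 hT).2⟩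

lemma convexHull_subset (hT : T ∈ 𝒯.elements) :
    convexHull ℝ (T : Set (Euc d)) ⊆ closure Ω := by
  rw [← 𝒯.space_eq]
  exact 𝒯.complex.convexHull_subset_space (𝒯.mem_elements_iff.1 hT).1

variable (𝒯) in
lemma exists_mem_convexHull (hx : x ∈ closure Ω) :
    ∃ T ∈ 𝒯.elements, x ∈ convexHull ℝ (T : Set (Euc d)) := by
  rw [← 𝒯.space_eq, Geometry.SimplicialComplex.mem_space_iff] at hx
  obtain ⟨s, hs, hxs⟩ := hx
  obtain ⟨T, hT, hsT, hcard⟩ := 𝒯.pure s hs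
  exact ⟨T, 𝒯.mem_elements_iff.2 ⟨hT, hcard⟩, convexHull_mono (by exact_mod_cast hsT) hxs⟩

lemma isCompact_closure (𝒯 : Triangulation Ω) : IsCompact (closure Ω) := by
  have : closure Ω = ⋃ T ∈ 𝒯.elements, convexHull ℝ (T : Set (Euc d)) := by
    refine Subset.antisymm (fun x hx => ?_) (iUnion₂_subset fun T hT => convexHull_subset hT)
    obtain ⟨T, hT, hxT⟩ := 𝒯.exists_mem_convexHull hx
    exact mem_biUnion hT hxT
  rw [this]
  exact 𝒯.elements.isCompact_biUnion fun T _ => isCompact_convexHull_finset T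

lemma openCell_subset (hΩ : HasLipschitzBoundary Ω) (hΩo : IsOpen Ω) (hT : T ∈ 𝒯.elements) :
    openCell T ⊆ Ω := by
  rw [← hΩ.interior_closure hΩo]
  exact interior_mono (convexHull_subset hT)

/-- If a point common to two elements has a positive barycentric coordinate in the first, then the
corresponding vertex is shared. -/
lemma mem_of_bary_pos (hT : T ∈ 𝒯.elements) (hT' : T' ∈ 𝒯.elements)
    (hx : x ∈ convexHull ℝ (T : Set (Euc d))) (hx' : x ∈ convexHull ℝ (T' : Set (Euc d)))
    (hb : b ∈ T) (hpos : 0 < bary T b x) : b ∈ T' := by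
  by_contra hbT'
  have h1 := 𝒯.complex.inter_subset_convexHull (𝒯.mem_elements_iff.1 hT).1
    (𝒯.mem_elements_iff.1 hT').1 ⟨hx, hx'⟩
  have h2 : x ∈ facet T b := by
    refine convexHull_mono ?_ h1
    rintro y ⟨hy, hy'⟩
    refine ⟨hy, fun hyb => hbT' ?_⟩
    rw [mem_singleton_iff] at hyb
    rw [← hyb]; exact hy'
  rw [((isSimplex hT).mem_facet_iff hb).1 h2 |>.1] at hpos
  exact hpos.false

lemma eq_of_mem_openCell (hd : 1 ≤ d) (hT : T ∈ 𝒯.elements) (hT' : T' ∈ 𝒯.elements)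
    (hx : x ∈ openCell T) (hx' : x ∈ openCell T') : T = T' := by
  refine Finset.eq_of_subset_of_card_le (fun b hb => ?_) ?_
  · exact mem_of_bary_pos hT hT' (interior_subset hx) (interior_subset hx') hb
      (((isSimplex hT).mem_openCell_iff hd).1 hx b hb)
  · rw [(isSimplex hT).2, (isSimplex hT').2]

variable (𝒯) in
/-- The open elements cover the domain up to a null set. -/
lemma ae_exists_mem_openCell : ∀ᵐ x ∂volume.restrict Ω, ∃ T ∈ 𝒯.elements, x ∈ openCell T := by
  have h1 : ∀ᵐ x : Euc d, ∀ T ∈ 𝒯.elements, x ∉ frontier (convexHull ℝ (T : Set (Euc d))) := by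
    rw [Finset.eventually_all]
    intro T _
    exact measure_eq_zero_iff_ae_notMem.1 ((convex_convexHull ℝ _).addHaar_frontier volume)
  exact ae_restrict_of_ae_restrict_of_subset (t := closure Ω) subset_closure
    ((ae_restrict_iff' isClosed_closure.measurableSet).2 (by
      filter_upwards [h1] with x hx hxΩ
      obtain ⟨T, hT, hxT⟩ := 𝒯.exists_mem_convexHull hxΩ
      refine ⟨T, hT, ?_⟩
      by_contra hcon
      exact hx T hT ⟨subset_closure hxT, hcon⟩))

/-- A facet that is not contained in the boundary is shared by a second element. -/
lemma exists_neighbor (hd : 1 ≤ d) (hΩo : IsOpen Ω) (hT : T ∈ 𝒯.elements) (ha : a ∈ T)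
    (hF : ¬ facet T a ⊆ frontier Ω) :
    ∃ T' ∈ 𝒯.elements, T' ≠ T ∧ ∃ a' ∈ T', T'.erase a' = T.erase a := by
  have hs := isSimplex hT
  obtain ⟨x, hx, hxf⟩ : ∃ x ∈ facetInterior T a, x ∉ frontier Ω := by
    by_contra! hcon
    exact hF ((hs.facet_subset_closure hd ha).trans (closure_minimal hcon isClosed_frontier))
  have hxT : x ∈ convexHull ℝ (T : Set (Euc d)) :=
    convexHull_mono sdiff_subset (hs.facetInterior_subset ha hx)
  have hxΩ : x ∈ Ω := by
    by_contra hcon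
    refine hxf ⟨convexHull_subset hT hxT, fun h => hcon (interior_subset h)⟩
  have hc : Continuous fun ε : ℝ => x + ε • outwardNormal T a := by fun_prop
  have ht := (hc.tendsto 0).mono_left (nhdsWithin_le_nhds (s := Ioi 0))
  simp only [zero_smul, add_zero] at ht
  have hclosed : IsClosed (⋃ T' ∈ 𝒯.elements.erase T, convexHull ℝ (T' : Set (Euc d))) :=
    isClosed_biUnion_finset fun T' _ => (isCompact_convexHull_finset T').isClosed
  have hmem : x ∈ ⋃ T' ∈ 𝒯.elements.erase T, convexHull ℝ (T' : Set (Euc d)) := by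
    refine hclosed.mem_of_tendsto ht ?_
    filter_upwards [ht.eventually (hΩo.mem_nhds hxΩ), self_mem_nhdsWithin] with ε h1 h2
    obtain ⟨T', hT', hxT'⟩ := 𝒯.exists_mem_convexHull (subset_closure h1)
    refine mem_biUnion (Finset.mem_erase.2 ⟨?_, hT'⟩) hxT'
    rintro rfl
    exact hs.add_smul_notMem hd ha hx h2 hxT'
  simp only [mem_iUnion, Finset.mem_erase] at hmem
  obtain ⟨T', ⟨hne, hT'⟩, hxT'⟩ := hmem
  refine ⟨T', hT', hne, ?_⟩
  have hsub : T.erase a ⊆ T' := fun b hb =>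
    mem_of_bary_pos hT hT' hxT hxT' (Finset.mem_of_mem_erase hb)
      (hx.2 b (Finset.mem_of_mem_erase hb) (Finset.ne_of_mem_erase hb))
  have hcard : (T.erase a).card + 1 = T'.card := by
    rw [Finset.card_erase_of_mem ha, hs.2, (isSimplex hT').2]; rfl
  obtain ⟨a', ha', heq⟩ := Finset.exists_eq_insert_iff.2 ⟨hsub, hcard⟩
  refine ⟨a', by rw [← heq]; exact Finset.mem_insert_self _ _, ?_⟩
  rw [← heq, Finset.erase_insert ha']

/-- Distinct elements with a common facet lie on opposite sides of it. -/
lemma outwardNormal_neighbor (hd : 1 ≤ d) (hT : T ∈ 𝒯.elements) (hT' : T' ∈ 𝒯.elements)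
    (hne : T' ≠ T) (ha : a ∈ T) (ha' : a' ∈ T') (h : T'.erase a' = T.erase a) :
    outwardNormal T' a' = -outwardNormal T a := by
  refine ((isSimplex hT).outwardNormal_eq_or_eq_neg (isSimplex hT') hd ha ha' h).resolve_left
    fun heq => hne ?_
  have h1 := (isSimplex hT).barycenter_mem hd ha
  have h2 := (isSimplex hT').barycenter_mem hd ha'
  rw [h] at h2
  have h3 := (isSimplex hT).eventually_mem_openCell hd ha h1 one_pos
  have h4 := (isSimplex hT').eventually_mem_openCell hd ha' h2 one_pos
  rw [heq] at h4
  obtain ⟨ε, h5, h6⟩ := (h3.and h4).exists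
  exact (eq_of_mem_openCell hd hT hT' h5 h6).symm

/-- At most two elements share a facet. -/
lemma eq_or_eq_of_erase_eq (hd : 1 ≤ d) {T₁ T₂ T₃ : Finset (Euc d)} {a₁ a₂ a₃ : Euc d}
    (h₁ : T₁ ∈ 𝒯.elements) (h₂ : T₂ ∈ 𝒯.elements) (h₃ : T₃ ∈ 𝒯.elements)
    (ha₁ : a₁ ∈ T₁) (ha₂ : a₂ ∈ T₂) (ha₃ : a₃ ∈ T₃) (hne : T₂ ≠ T₁)
    (h₂₁ : T₂.erase a₂ = T₁.erase a₁) (h₃₁ : T₃.erase a₃ = T₁.erase a₁) :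
    T₃ = T₁ ∨ T₃ = T₂ := by
  by_contra! hcon
  have e1 := outwardNormal_neighbor hd h₁ h₂ hne ha₁ ha₂ h₂₁
  have e2 := outwardNormal_neighbor hd h₁ h₃ hcon.1 ha₁ ha₃ h₃₁
  have e3 := outwardNormal_neighbor hd h₂ h₃ hcon.2 ha₂ ha₃ (h₃₁.trans h₂₁.symm)
  rw [e1, e2, neg_neg] at e3
  have h0 : (2 : ℝ) • outwardNormal T₁ a₁ = 0 := by
    rw [two_smul]
    nth_rewrite 1 [← e3]
    rw [neg_add_cancel]
  exact (isSimplex h₁).outwardNormal_ne_zero hd ha₁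
    ((smul_eq_zero.1 h0).resolve_left two_ne_zero)

end Triangulation

/-- The vertex opposite to a given facet is determined by the simplex. -/
lemma eq_of_erase_eq_erase {T : Finset (Euc d)} {a a' : Euc d} (ha : a ∈ T)
    (h : T.erase a = T.erase a') : a = a' := by
  by_contra hne
  exact Finset.notMem_erase a T (h ▸ Finset.mem_erase.2 ⟨hne, ha⟩)

/-! ### Polynomial functions and vector fields -/

/-- The function on `ℝ^d` given by a polynomial. -/
noncomputable def polyFun (P : MvPolynomial (Fin d) ℝ) (x : Euc d) : ℝ :=
  MvPolynomial.eval (fun i => x i) P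

/-- The vector field on `ℝ^d` whose components are given by polynomials. -/
noncomputable def polyField (P : Fin d → MvPolynomial (Fin d) ℝ) (x : Euc d) : Euc d :=
  WithLp.toLp 2 fun i => polyFun (P i) x

/-- The divergence of a polynomial vector field. -/
noncomputable def polyDiv (P : Fin d → MvPolynomial (Fin d) ℝ) : MvPolynomial (Fin d) ℝ :=
  ∑ i, MvPolynomial.pderiv i (P i)

@[simp] lemma polyField_apply (P : Fin d → MvPolynomial (Fin d) ℝ) (x : Euc d) (i : Fin d) :
    polyField P x i = polyFun (P i) x := rfl

lemma contDiff_polyFun (P : MvPolynomial (Fin d) ℝ) : ContDiff ℝ ∞ (polyFun P) := by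
  have h := AnalyticOnNhd.eval_continuousLinearMap' (𝕜 := ℝ) (E := Euc d)
    (fun i => EuclideanSpace.proj i) P
  exact h.contDiff

lemma contDiff_polyField (P : Fin d → MvPolynomial (Fin d) ℝ) : ContDiff ℝ ∞ (polyField P) :=
  contDiff_euclidean.2 fun i => contDiff_polyFun (P i)

lemma hasFDerivAt_polyFun (P : MvPolynomial (Fin d) ℝ) (x : Euc d) :
    HasFDerivAt (polyFun P)
      (∑ i, polyFun (MvPolynomial.pderiv i P) x • (EuclideanSpace.proj i : Euc d →L[ℝ] ℝ)) x := by
  classical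
  induction P using MvPolynomial.induction_on with
  | C r =>
    have : polyFun (MvPolynomial.C r : MvPolynomial (Fin d) ℝ) = fun _ => r := by
      funext y; simp [polyFun]
    rw [this]
    simpa [polyFun] using hasFDerivAt_const r x
  | add p q hp hq =>
    have : polyFun (p + q) = polyFun p + polyFun q := by funext y; simp [polyFun]
    rw [this]
    refine (hp.add hq).congr_fderiv ?_
    ext v
    simp [polyFun, add_mul, Finset.sum_add_distrib]
  | mul_X p j hp =>
    have : polyFun (p * MvPolynomial.X j) =
        polyFun p * fun y : Euc d => (EuclideanSpace.proj j : Euc d →L[ℝ] ℝ) y := by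
      funext y; simp [polyFun]
    rw [this]
    refine (hp.mul (EuclideanSpace.proj j : Euc d →L[ℝ] ℝ).hasFDerivAt).congr_fderiv ?_
    have hpd : ∀ i, polyFun (MvPolynomial.pderiv i (p * MvPolynomial.X j)) x =
        polyFun (MvPolynomial.pderiv i p) x * x j + polyFun p x * if j = i then 1 else 0 := by
      intro i
      by_cases hij : j = i <;> simp [polyFun, hij, mul_comm, add_comm]
    ext v
    simp only [hpd, add_smul, Finset.sum_add_distrib]
    simp only [add_apply, sum_apply, smul_apply, PiLp.proj_apply, smul_eq_mul, mul_ite, mul_one,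
      mul_zero, ite_mul, zero_mul, Finset.sum_ite_eq, Finset.mem_univ, if_true, Finset.mul_sum]
    rw [add_comm]
    congr 1
    refine Finset.sum_congr rfl fun i _ => ?_
    ring

lemma fderiv_polyFun_single (P : MvPolynomial (Fin d) ℝ) (x : Euc d) (i : Fin d) :
    fderiv ℝ (polyFun P) x (EuclideanSpace.single i 1) =
      polyFun (MvPolynomial.pderiv i P) x := by
  classical
  rw [(hasFDerivAt_polyFun P x).fderiv]
  simp

/-- A polynomial is determined by its values on a nonempty open set. -/
lemma eq_zero_of_polyFun_eq_zero {P : MvPolynomial (Fin d) ℝ} {S : Set (Euc d)} (hS : IsOpen S)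
    (hne : S.Nonempty) (h : ∀ x ∈ S, polyFun P x = 0) : P = 0 := by
  obtain ⟨x, hx⟩ := hne
  have hc : Continuous fun y : Fin d → ℝ => (WithLp.toLp 2 y : Euc d) := by fun_prop
  have ho := hS.preimage hc
  obtain ⟨ε, hε, hball⟩ := Metric.isOpen_iff.1 ho (fun i => x i) (by simpa using hx)
  refine MvPolynomial.funext_set (fun i => Metric.ball (x i) ε) (fun i => ?_) fun y hy => ?_
  · rw [Real.ball_eq_Ioo]; exact Ioo_infinite (by linarith)
  · rw [map_zero]
    have h1 : y ∈ Metric.ball (fun i => x i) ε := by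
      rw [ball_pi _ hε]; exact hy
    exact h _ (hball h1)

lemma totalDegree_le_of_coeff {P : MvPolynomial (Fin d) ℝ} {n : ℕ}
    (h : ∀ m : Fin d →₀ ℕ, n < m.degree → P.coeff m = 0) : P.totalDegree ≤ n := by
  refine Finset.sup_le fun m hm => ?_
  by_contra! hlt
  exact MvPolynomial.mem_support_iff.1 hm (h m hlt)

lemma coeff_eq_zero_of_totalDegree_le {P : MvPolynomial (Fin d) ℝ} {n : ℕ}
    (hP : P.totalDegree ≤ n) {m : Fin d →₀ ℕ} (hm : n < m.degree) : P.coeff m = 0 := by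
  by_contra hne
  exact absurd ((MvPolynomial.le_totalDegree (MvPolynomial.mem_support_iff.2 hne)).trans hP)
    (not_le.2 hm)

lemma totalDegree_polyDiv_le {P : Fin d → MvPolynomial (Fin d) ℝ} {n : ℕ}
    (hP : ∀ i, (P i).totalDegree ≤ n) : (polyDiv P).totalDegree ≤ n - 1 := by
  refine totalDegree_le_of_coeff fun m hm => ?_
  rw [polyDiv, MvPolynomial.coeff_sum]
  refine Finset.sum_eq_zero fun i _ => ?_
  rw [MvPolynomial.coeff_pderiv,
    coeff_eq_zero_of_totalDegree_le (hP i) (m := m + Finsupp.single i 1)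
    (by rw [map_add, Finsupp.degree_single]; omega), zero_mul]

/-- A divergence-free field in `RT_k = P_k^d + P_k x` belongs to `P_k^d`: the homogeneous part of
degree `k` of `div (w + q x)` is `d + k` times that of `q`. -/
lemma totalDegree_le_of_polyDiv_eq_zero (hd : 1 ≤ d) {k : ℕ} {W : Fin d → MvPolynomial (Fin d) ℝ}
    {Q : MvPolynomial (Fin d) ℝ} (hW : ∀ i, (W i).totalDegree ≤ k) (hQ : Q.totalDegree ≤ k)
    (hdiv : polyDiv (fun i => W i + Q * MvPolynomial.X i) = 0) (i : Fin d) :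
    (W i + Q * MvPolynomial.X i).totalDegree ≤ k := by
  classical
  have hQk : ∀ m : Fin d →₀ ℕ, k ≤ m.degree → Q.coeff m = 0 := by
    intro m hm
    rcases hm.lt_or_eq with hlt | heq
    · exact coeff_eq_zero_of_totalDegree_le hQ hlt
    have h1 := congrArg (MvPolynomial.coeff m) hdiv
    rw [polyDiv, MvPolynomial.coeff_sum, MvPolynomial.coeff_zero] at h1
    have h2 : ∀ i : Fin d, (MvPolynomial.pderiv i (W i + Q * MvPolynomial.X i)).coeff m =
        Q.coeff m * (m i + 1) := by
      intro i
      rw [MvPolynomial.coeff_pderiv, MvPolynomial.coeff_add, MvPolynomial.coeff_mul_X,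
        coeff_eq_zero_of_totalDegree_le (hW i) (m := m + Finsupp.single i 1)
        (by rw [map_add, Finsupp.degree_single]; omega), zero_add]
    rw [Finset.sum_congr rfl fun i _ => h2 i, ← Finset.mul_sum] at h1
    refine (mul_eq_zero.1 h1).resolve_right (ne_of_gt ?_)
    refine Finset.sum_pos (fun i _ => by positivity) ?_
    exact ⟨⟨0, hd⟩, Finset.mem_univ _⟩
  refine (MvPolynomial.totalDegree_add _ _).trans (max_le (hW i) ?_)
  refine totalDegree_le_of_coeff fun m hm => ?_
  rw [MvPolynomial.coeff_mul_X']
  split_ifs with hi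
  · refine hQk _ ?_
    have h3 : m - Finsupp.single i 1 + Finsupp.single i 1 = m := by
      refine tsub_add_cancel_of_le ?_
      rw [Finsupp.single_le_iff]
      exact Nat.one_le_iff_ne_zero.2 (Finsupp.mem_support_iff.1 hi)
    have h4 := congrArg Finsupp.degree h3
    rw [map_add, Finsupp.degree_single] at h4
    omega
  · rfl

/-! ### Weak divergence of piecewise polynomial fields -/

/-- On an open set where a field is smooth, its weak divergence is the classical one. -/
lemma IsWeakDiv.ae_eq {Ω S : Set (Euc d)} {v : Euc d → Euc d} {g : Euc d → ℝ}
    (h : IsWeakDiv Ω v g) (hΩ : volume Ω ≠ ⊤) (hS : IsOpen S) (hSΩ : S ⊆ Ω)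
    {P : Fin d → MvPolynomial (Fin d) ℝ} (hv : ∀ x ∈ S, v x = polyField P x) :
    ∀ᵐ x, x ∈ S → g x = polyFun (polyDiv P) x := by
  have : IsFiniteMeasure (volume.restrict Ω) := isFiniteMeasure_restrict.2 hΩ
  have hg : IntegrableOn g Ω := h.1.integrable (by norm_num)
  have hDc : Continuous (polyFun (polyDiv P)) := (contDiff_polyFun _).continuous
  have hloc : LocallyIntegrableOn (fun x => g x - polyFun (polyDiv P) x) S :=
    (hg.mono_set hSΩ).locallyIntegrableOn.sub (hDc.locallyIntegrable.locallyIntegrableOn S)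
  refine (hS.ae_eq_zero_of_integral_contDiff_smul_eq_zero hloc ?_).mono
    fun x hx hxS => sub_eq_zero.1 (hx hxS)
  intro φ hφ hφc hφS
  have hvanish : ∀ x, x ∉ S → φ x = 0 := fun x hx =>
    image_eq_zero_of_notMem_tsupport fun h => hx (hφS h)
  have hvanish' : ∀ x, x ∉ S → fderiv ℝ φ x = 0 := fun x hx =>
    fderiv_of_notMem_tsupport (𝕜 := ℝ) fun h => hx (hφS h)
  have h1 := h.2 φ hφ hφc (hφS.trans hSΩ)
  have hL : ∫ x in Ω, fderiv ℝ φ x (v x) = ∫ x, fderiv ℝ φ x (polyField P x) := by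
    rw [← setIntegral_eq_integral_of_forall_compl_eq_zero (s := Ω) (μ := volume)
      (f := fun x => fderiv ℝ φ x (polyField P x))
      fun x hx => by rw [hvanish' x fun hs => hx (hSΩ hs)]; rfl]
    refine integral_congr_ae (ae_of_all _ fun x => ?_)
    by_cases hx : x ∈ S
    · simp only [hv x hx]
    · simp only [hvanish' x hx]; rfl
  have hR : ∫ x in Ω, g x * φ x = ∫ x, g x * φ x :=
    setIntegral_eq_integral_of_forall_compl_eq_zero
      fun x hx => by rw [hvanish x fun hs => hx (hSΩ hs), mul_zero]
  have hφ1 : Continuous φ := hφ.continuous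
  have hφ' : ∀ i : Fin d, Continuous fun x => fderiv ℝ φ x (EuclideanSpace.single i 1) := fun i =>
    (hφ.continuous_fderiv (by simp)).clm_apply continuous_const
  have hφ'c : ∀ i : Fin d, HasCompactSupport fun x => fderiv ℝ φ x (EuclideanSpace.single i 1) :=
    fun i => hφc.fderiv_apply (𝕜 := ℝ) _
  have hsplit : ∀ x, fderiv ℝ φ x (polyField P x) =
      ∑ i, polyFun (P i) x * fderiv ℝ φ x (EuclideanSpace.single i 1) := by
    intro x
    have h2 : polyField P x = ∑ i, polyFun (P i) x • EuclideanSpace.single i (1 : ℝ) := by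
      ext j; simp [Pi.single_apply]
    rw [h2, map_sum]
    simp only [map_smul, smul_eq_mul]
  have hibp : ∀ i, ∫ x, polyFun (P i) x * fderiv ℝ φ x (EuclideanSpace.single i 1) =
      -∫ x, polyFun (MvPolynomial.pderiv i (P i)) x * φ x := by
    intro i
    have hp := (contDiff_polyFun (P i)).continuous
    have hp' := (contDiff_polyFun (MvPolynomial.pderiv i (P i))).continuous
    have h3 := integral_mul_fderiv_eq_neg_fderiv_mul_of_integrable (μ := volume)
      (f := polyFun (P i)) (g := φ) (v := EuclideanSpace.single i 1)
      (by
        simp only [fderiv_polyFun_single]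
        exact (hp'.mul hφ1).integrable_of_hasCompactSupport hφc.mul_left)
      ((hp.mul (hφ' i)).integrable_of_hasCompactSupport (hφ'c i).mul_left)
      ((hp.mul hφ1).integrable_of_hasCompactSupport hφc.mul_left)
      (fun x _ => (contDiff_polyFun (P i)).differentiable (by simp) x)
      (fun x _ => hφ.differentiable (by simp) x)
    simpa only [fderiv_polyFun_single] using h3
  have hint : ∀ Q : MvPolynomial (Fin d) ℝ, Integrable fun x => polyFun Q x * φ x := fun Q =>
    ((contDiff_polyFun Q).continuous.mul hφ1).integrable_of_hasCompactSupport hφc.mul_left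
  have hdiv : ∫ x, fderiv ℝ φ x (polyField P x) = -∫ x, polyFun (polyDiv P) x * φ x := by
    simp only [hsplit]
    have h3 : ∀ i, Integrable fun x =>
        polyFun (P i) x * fderiv ℝ φ x (EuclideanSpace.single i 1) := fun i =>
      ((contDiff_polyFun (P i)).continuous.mul (hφ' i)).integrable_of_hasCompactSupport
        (hφ'c i).mul_left
    rw [integral_finsetSum _ fun i _ => h3 i]
    simp only [hibp]
    rw [Finset.sum_neg_distrib, ← integral_finsetSum _ fun i _ => hint _]
    congr 2
    funext x
    simp [polyDiv, polyFun, Finset.sum_mul]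
  rw [hL, hR, hdiv, neg_inj] at h1
  have hgi : Integrable fun x => g x * φ x := by
    obtain ⟨C, hC⟩ := hφc.exists_bound_of_continuous hφ1
    have h4 : IntegrableOn (fun x => g x * φ x) Ω :=
      hg.mul_bdd (c := C) hφ1.aestronglyMeasurable (ae_of_all _ hC)
    exact (integrableOn_iff_integrable_of_support_subset fun x hx => by
      by_contra hxΩ
      exact hx (by simp only [hvanish x fun hs => hxΩ (hSΩ hs), mul_zero])).1 h4
  simp only [smul_eq_mul]
  have h5 : ∀ x, φ x * (g x - polyFun (polyDiv P) x) = g x * φ x - polyFun (polyDiv P) x * φ x :=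
    fun x => by ring
  simp only [h5]
  rw [integral_sub hgi (hint _), h1, sub_self]

lemma MemHdiv.isWeakDiv_weakDiv {Ω : Set (Euc d)} {v : Euc d → Euc d} (h : MemHdiv Ω v) :
    IsWeakDiv Ω v (weakDiv Ω v) :=
  Classical.epsilon_spec h.2

/-- The divergence of a field in `H₀(div, Ω)` has mean value zero. -/
lemma MemHdivZero.integral_weakDiv {Ω : Set (Euc d)} {v : Euc d → Euc d} (h : MemHdivZero Ω v)
    (hΩ : Bornology.IsBounded Ω) (hΩo : IsOpen Ω) : ∫ x in Ω, weakDiv Ω v x = 0 := by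
  obtain ⟨R, hR, hΩR⟩ := hΩ.subset_ball_lt 0 0
  let φ : ContDiffBump (0 : Euc d) := ⟨R, R + 1, hR, by linarith⟩
  have h1 := h.2 φ φ.contDiff φ.hasCompactSupport
  rw [normalTrace] at h1
  rw [← h1]
  refine setIntegral_congr_fun hΩo.measurableSet fun x hx => ?_
  have h2 : (φ : Euc d → ℝ) =ᶠ[𝓝 x] fun _ => 1 := by
    filter_upwards [Metric.isOpen_ball.mem_nhds (hΩR hx)] with y hy
    exact φ.one_of_mem_closedBall (Metric.ball_subset_closedBall hy)
  rw [h2.fderiv_eq, h2.eq_of_nhds]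
  simp

end HdivUpwind

namespace HdivUpwind

variable {d : ℕ} {Ω : Set (Euc d)}

/-! ### Divergence-free fields -/

/-- `v ∈ L²(Ω)^d` is divergence free and has vanishing normal trace. Since the test functions do not
have to vanish on the boundary, one identity expresses both properties. -/
def IsDivFree (Ω : Set (Euc d)) (v : Euc d → Euc d) : Prop :=
  MemLp v 2 (volume.restrict Ω) ∧
    ∀ φ : Euc d → ℝ, ContDiff ℝ ∞ φ → HasCompactSupport φ → ∫ x in Ω, fderiv ℝ φ x (v x) = 0

lemma integrable_fderiv_apply {v : Euc d → Euc d} (hΩ : volume Ω ≠ ⊤)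
    (hv : MemLp v 2 (volume.restrict Ω)) {φ : Euc d → ℝ} (hφ : ContDiff ℝ ∞ φ)
    (hφc : HasCompactSupport φ) : IntegrableOn (fun x => fderiv ℝ φ x (v x)) Ω := by
  have : IsFiniteMeasure (volume.restrict Ω) := isFiniteMeasure_restrict.2 hΩ
  have hv1 : Integrable v (volume.restrict Ω) := hv.integrable (by norm_num)
  have hc : Continuous (fderiv ℝ φ) := hφ.continuous_fderiv (by simp)
  obtain ⟨C, hC⟩ := (hφc.fderiv (𝕜 := ℝ)).exists_bound_of_continuous hc
  refine (hv1.norm.const_mul C).mono' ?_ (ae_of_all _ fun x => ?_)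
  · have hb := (isBoundedBilinearMap_apply (𝕜 := ℝ) (E := Euc d) (F := ℝ)).continuous
    exact hb.comp_aestronglyMeasurable
      (hc.aestronglyMeasurable.prodMk hv1.aestronglyMeasurable)
  · exact (ContinuousLinearMap.le_opNorm _ _).trans
      (mul_le_mul_of_nonneg_right (hC x) (norm_nonneg _))

lemma IsDivFree.sub {v v' : Euc d → Euc d} (hΩ : volume Ω ≠ ⊤) (h : IsDivFree Ω v)
    (h' : IsDivFree Ω v') : IsDivFree Ω (fun x => v x - v' x) := by
  refine ⟨h.1.sub h'.1, fun φ hφ hφc => ?_⟩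
  simp only [map_sub]
  rw [integral_sub (integrable_fderiv_apply hΩ h.1 hφ hφc)
    (integrable_fderiv_apply hΩ h'.1 hφ hφc), h.2 φ hφ hφc, h'.2 φ hφ hφc, sub_zero]

lemma IsDivFree.memHdiv {v : Euc d → Euc d} (h : IsDivFree Ω v) : MemHdiv Ω v :=
  ⟨h.1, 0, MemLp.zero, fun φ hφ hφc _ => by simp [h.2 φ hφ hφc]⟩

lemma normalTrace_of_weakDiv_eq_zero {v : Euc d → Euc d}
    (hdiv : weakDiv Ω v =ᵐ[volume.restrict Ω] 0) (φ : Euc d → ℝ) :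
    normalTrace Ω v φ = ∫ x in Ω, fderiv ℝ φ x (v x) := by
  refine integral_congr_ae (hdiv.mono fun x hx => ?_)
  simp only [hx, Pi.zero_apply, zero_mul, add_zero]

lemma MemHdivZero.isDivFree {v : Euc d → Euc d} (h : MemHdivZero Ω v)
    (hdiv : weakDiv Ω v =ᵐ[volume.restrict Ω] 0) : IsDivFree Ω v :=
  ⟨h.1.1, fun φ hφ hφc => by rw [← normalTrace_of_weakDiv_eq_zero hdiv, h.2 φ hφ hφc]⟩

lemma IsDivFree.memHdivZero {v : Euc d → Euc d} (h : IsDivFree Ω v)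
    (hdiv : weakDiv Ω v =ᵐ[volume.restrict Ω] 0) : MemHdivZero Ω v :=
  ⟨h.memHdiv, fun φ hφ hφc => by
    rw [normalTrace_of_weakDiv_eq_zero hdiv]; exact h.2 φ hφ hφc⟩

/-! ### Piecewise polynomial fields -/

/-- On each open element, `v` is given by the polynomials `P T`. -/
def IsPiecewise (𝒯 : Triangulation Ω) (v : Euc d → Euc d)
    (P : Finset (Euc d) → Fin d → MvPolynomial (Fin d) ℝ) : Prop :=
  ∀ T ∈ 𝒯.elements, ∀ x ∈ openCell T, v x = polyField (P T) x

variable {𝒯 : Triangulation Ω} {v : Euc d → Euc d}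
  {P : Finset (Euc d) → Fin d → MvPolynomial (Fin d) ℝ}

lemma IsPiecewise.sub {v' : Euc d → Euc d}
    {P' : Finset (Euc d) → Fin d → MvPolynomial (Fin d) ℝ} (h : IsPiecewise 𝒯 v P)
    (h' : IsPiecewise 𝒯 v' P') :
    IsPiecewise 𝒯 (fun x => v x - v' x) (fun T i => P T i - P' T i) := by
  intro T hT x hx
  simp only [h T hT x hx, h' T hT x hx]
  ext i
  simp [polyFun]

lemma IsPiecewise.isVecPolyOn (h : IsPiecewise 𝒯 v P) {k : ℕ} {T : Finset (Euc d)}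
    (hT : T ∈ 𝒯.elements) (hdeg : ∀ i, (P T i).totalDegree ≤ k) : IsVecPolyOn k (openCell T) v :=
  fun i => ⟨P T i, hdeg i, fun x hx => by simp only [h T hT x hx]; rfl⟩

lemma IsVecPolyOn.exists_poly {k : ℕ} {S : Set (Euc d)} (h : IsVecPolyOn k S v) :
    ∃ W : Fin d → MvPolynomial (Fin d) ℝ, (∀ i, (W i).totalDegree ≤ k) ∧
      ∀ x ∈ S, v x = polyField W x := by
  choose W hW hv using h
  refine ⟨W, hW, fun x hx => ?_⟩
  ext i
  exact hv i x hx

lemma IsVecPolyOn.isRTOn {k : ℕ} {S : Set (Euc d)} (h : IsVecPolyOn k S v) : IsRTOn k S v :=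
  ⟨v, 0, h, ⟨0, by simp, by simp⟩, by simp⟩

lemma IsRTOn.exists_poly {k : ℕ} {S : Set (Euc d)} (h : IsRTOn k S v) :
    ∃ (W : Fin d → MvPolynomial (Fin d) ℝ) (Q : MvPolynomial (Fin d) ℝ),
      (∀ i, (W i).totalDegree ≤ k) ∧ Q.totalDegree ≤ k ∧
      ∀ x ∈ S, v x = polyField (fun i => W i + Q * MvPolynomial.X i) x := by
  obtain ⟨w, q, hw, ⟨Q, hQ, hq⟩, hv⟩ := h
  obtain ⟨W, hW, hw⟩ := hw.exists_poly
  refine ⟨W, Q, hW, hQ, fun x hx => ?_⟩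
  rw [hv x hx, hw x hx, hq x hx]
  ext i
  simp [polyFun]

lemma Triangulation.volume_ne_top (𝒯 : Triangulation Ω) : volume Ω ≠ ⊤ :=
  ((measure_mono subset_closure).trans_lt 𝒯.isCompact_closure.measure_lt_top).ne

lemma Triangulation.isBounded (𝒯 : Triangulation Ω) : Bornology.IsBounded Ω :=
  𝒯.isCompact_closure.isBounded.subset subset_closure

lemma Triangulation.openCell_nonempty (hd : 1 ≤ d) {T : Finset (Euc d)} (hT : T ∈ 𝒯.elements) :
    (openCell T).Nonempty := by
  have hs := isSimplex hT
  obtain ⟨a, ha⟩ : T.Nonempty := by rw [← Finset.card_pos, hs.2]; omega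
  obtain ⟨ε, hε⟩ := (hs.eventually_mem_openCell hd ha (hs.barycenter_mem hd ha) one_pos).exists
  exact ⟨_, hε⟩

/-- The weak divergence of a piecewise polynomial field is given by the divergences of its pieces.
-/
lemma IsPiecewise.ae_weakDiv_eq (hΩL : HasLipschitzBoundary Ω) (hΩo : IsOpen Ω)
    (h : IsPiecewise 𝒯 v P) (hv : MemHdiv Ω v) :
    ∀ᵐ x ∂volume.restrict Ω, ∃ T ∈ 𝒯.elements, x ∈ openCell T ∧
      weakDiv Ω v x = polyFun (polyDiv (P T)) x := by
  have h1 : ∀ᵐ x, ∀ T ∈ 𝒯.elements, x ∈ openCell T →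
      weakDiv Ω v x = polyFun (polyDiv (P T)) x := by
    rw [Finset.eventually_all]
    intro T hT
    exact hv.isWeakDiv_weakDiv.ae_eq 𝒯.volume_ne_top isOpen_interior
      (Triangulation.openCell_subset hΩL hΩo hT) (h T hT)
  filter_upwards [ae_restrict_of_ae h1, 𝒯.ae_exists_mem_openCell] with x hx ⟨T, hT, hxT⟩
  exact ⟨T, hT, hxT, hx T hT hxT⟩

lemma IsPiecewise.weakDiv_ae_eq_zero (hΩL : HasLipschitzBoundary Ω) (hΩo : IsOpen Ω)
    (h : IsPiecewise 𝒯 v P) (hv : MemHdiv Ω v) (hdiv : ∀ T ∈ 𝒯.elements, polyDiv (P T) = 0) :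
    weakDiv Ω v =ᵐ[volume.restrict Ω] 0 := by
  filter_upwards [h.ae_weakDiv_eq hΩL hΩo hv] with x ⟨T, hT, _, hx⟩
  rw [hx, hdiv T hT]
  simp [polyFun]

/-- If the divergences of the pieces belong to the pressure space, then testing the discrete
continuity equation with the divergence itself shows that the field is divergence free. -/
lemma IsPiecewise.polyDiv_eq_zero (hd : 1 ≤ d) (hΩL : HasLipschitzBoundary Ω) (hΩo : IsOpen Ω)
    (h : IsPiecewise 𝒯 v P) (hv : MemHdivZero Ω v) {m : ℕ}
    (hdeg : ∀ T ∈ 𝒯.elements, (polyDiv (P T)).totalDegree ≤ m)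
    (hcont : ∀ q ∈ spaceM 𝒯 m, ∫ x in Ω, weakDiv Ω v x * q x = 0) :
    ∀ T ∈ 𝒯.elements, polyDiv (P T) = 0 := by
  classical
  have : IsFiniteMeasure (volume.restrict Ω) := isFiniteMeasure_restrict.2 𝒯.volume_ne_top
  let q : Euc d → ℝ := fun x =>
    ∑ T ∈ 𝒯.elements, (openCell T).indicator (polyFun (polyDiv (P T))) x
  have hq : ∀ T ∈ 𝒯.elements, ∀ x ∈ openCell T, q x = polyFun (polyDiv (P T)) x := by
    intro T hT x hx
    have h1 := Finset.sum_eq_single_of_mem (s := 𝒯.elements)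
      (f := fun T => (openCell T).indicator (polyFun (polyDiv (P T))) x) T hT
      fun T' hT' hne => indicator_of_notMem (fun hx' =>
        hne (Triangulation.eq_of_mem_openCell hd hT' hT hx' hx)) _
    simp only [indicator_of_mem hx] at h1
    exact h1
  have hqL : MemLp q 2 (volume.restrict Ω) := by
    refine memLp_finsetSum _ fun T hT => MemLp.indicator isOpen_interior.measurableSet ?_
    have hc := (contDiff_polyFun (polyDiv (P T))).continuous
    obtain ⟨C, hC⟩ := 𝒯.isCompact_closure.exists_bound_of_continuousOn hc.continuousOn
    exact MemLp.of_bound hc.aestronglyMeasurable C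
      ((ae_restrict_iff' hΩo.measurableSet).2 (ae_of_all _ fun x hx => hC x (subset_closure hx)))
  have hae : q =ᵐ[volume.restrict Ω] weakDiv Ω v := by
    filter_upwards [h.ae_weakDiv_eq hΩL hΩo hv.1] with x ⟨T, hT, hxT, hx⟩
    rw [hx, hq T hT x hxT]
  have hqM : q ∈ spaceM 𝒯 m := by
    refine ⟨hqL, ?_, fun T hT => ⟨polyDiv (P T), hdeg T hT, hq T hT⟩⟩
    rw [integral_congr_ae hae]
    exact hv.integral_weakDiv 𝒯.isBounded hΩo
  have h0 : ∫ x in Ω, q x ^ 2 = 0 := by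
    rw [← hcont q hqM]
    refine integral_congr_ae (hae.mono fun x hx => ?_)
    simp only [← hx]; ring
  rw [integral_eq_zero_iff_of_nonneg (fun x => sq_nonneg _) hqL.integrable_sq] at h0
  intro T hT
  have hTΩ := Triangulation.openCell_subset hΩL hΩo hT
  refine eq_zero_of_polyFun_eq_zero isOpen_interior (Triangulation.openCell_nonempty hd hT) ?_
  have h1 : polyFun (polyDiv (P T)) =ᵐ[volume.restrict (openCell T)] fun _ => 0 := by
    filter_upwards [ae_restrict_of_ae_restrict_of_subset hTΩ h0,
      ae_restrict_mem isOpen_interior.measurableSet] with x hx hxT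
    rw [← hq T hT x hxT]
    exact pow_eq_zero_iff two_ne_zero |>.1 hx
  exact Measure.eqOn_open_of_ae_eq h1 isOpen_interior
    (contDiff_polyFun _).continuous.continuousOn continuousOn_const

/-- `v` is a divergence-free piecewise polynomial field of degree at most `k` with vanishing normal
trace, given by the polynomials `P T` on each element. -/
structure IsDivFreePiecewise (𝒯 : Triangulation Ω) (k : ℕ) (v : Euc d → Euc d)
    (P : Finset (Euc d) → Fin d → MvPolynomial (Fin d) ℝ) : Prop where
  isPiecewise : IsPiecewise 𝒯 v P
  totalDegree_le : ∀ T ∈ 𝒯.elements, ∀ i, (P T i).totalDegree ≤ k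
  polyDiv_eq_zero : ∀ T ∈ 𝒯.elements, polyDiv (P T) = 0
  isDivFree : IsDivFree Ω v

lemma IsDivFreePiecewise.sub {k : ℕ} {v' : Euc d → Euc d}
    {P' : Finset (Euc d) → Fin d → MvPolynomial (Fin d) ℝ} (h : IsDivFreePiecewise 𝒯 k v P)
    (h' : IsDivFreePiecewise 𝒯 k v' P') :
    IsDivFreePiecewise 𝒯 k (fun x => v x - v' x) (fun T i => P T i - P' T i) where
  isPiecewise := h.isPiecewise.sub h'.isPiecewise
  totalDegree_le T hT i := (MvPolynomial.totalDegree_sub _ _).trans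
    (max_le (h.totalDegree_le T hT i) (h'.totalDegree_le T hT i))
  polyDiv_eq_zero T hT := by
    have h1 := h.polyDiv_eq_zero T hT
    have h2 := h'.polyDiv_eq_zero T hT
    simp only [polyDiv] at h1 h2 ⊢
    simp only [map_sub, Finset.sum_sub_distrib, h1, h2, sub_zero]
  isDivFree := h.isDivFree.sub 𝒯.volume_ne_top h'.isDivFree

lemma IsDivFreePiecewise.weakDiv_ae_eq_zero {k : ℕ} (h : IsDivFreePiecewise 𝒯 k v P)
    (hΩL : HasLipschitzBoundary Ω) (hΩo : IsOpen Ω) : weakDiv Ω v =ᵐ[volume.restrict Ω] 0 :=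
  h.isPiecewise.weakDiv_ae_eq_zero hΩL hΩo h.isDivFree.memHdiv h.polyDiv_eq_zero

lemma IsDivFreePiecewise.mem_spaceBDM {k : ℕ} (h : IsDivFreePiecewise 𝒯 k v P)
    (hΩL : HasLipschitzBoundary Ω) (hΩo : IsOpen Ω) : v ∈ spaceBDM 𝒯 k :=
  ⟨h.isDivFree.memHdivZero (h.weakDiv_ae_eq_zero hΩL hΩo),
    fun T hT => h.isPiecewise.isVecPolyOn hT (h.totalDegree_le T hT)⟩

lemma IsDivFreePiecewise.mem_spaceRT {k : ℕ} (h : IsDivFreePiecewise 𝒯 k v P)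
    (hΩL : HasLipschitzBoundary Ω) (hΩo : IsOpen Ω) : v ∈ spaceRT 𝒯 k :=
  have h1 := h.mem_spaceBDM hΩL hΩo
  ⟨h1.1, fun T hT => (h1.2 T hT).isRTOn⟩

lemma exists_isDivFreePiecewise_of_mem_spaceBDM (hd : 1 ≤ d) (hΩL : HasLipschitzBoundary Ω)
    (hΩo : IsOpen Ω) {k : ℕ} (hv : v ∈ spaceBDM 𝒯 k)
    (hcont : ∀ q ∈ spaceM 𝒯 (k - 1), ∫ x in Ω, weakDiv Ω v x * q x = 0) :
    ∃ P, IsDivFreePiecewise 𝒯 k v P := by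
  have h1 : ∀ T, ∃ W : Fin d → MvPolynomial (Fin d) ℝ, T ∈ 𝒯.elements →
      (∀ i, (W i).totalDegree ≤ k) ∧ ∀ x ∈ openCell T, v x = polyField W x := by
    intro T
    by_cases hT : T ∈ 𝒯.elements
    · obtain ⟨W, hW⟩ := (hv.2 T hT).exists_poly
      exact ⟨W, fun _ => hW⟩
    · exact ⟨0, fun h => absurd h hT⟩
  choose P hP using h1
  have h2 : IsPiecewise 𝒯 v P := fun T hT => (hP T hT).2
  have h3 := h2.polyDiv_eq_zero hd hΩL hΩo hv.1
    (fun T hT => totalDegree_polyDiv_le (hP T hT).1) hcont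
  exact ⟨P, h2, fun T hT => (hP T hT).1, h3,
    hv.1.isDivFree (h2.weakDiv_ae_eq_zero hΩL hΩo hv.1.1 h3)⟩

lemma exists_isDivFreePiecewise_of_mem_spaceRT (hd : 1 ≤ d) (hΩL : HasLipschitzBoundary Ω)
    (hΩo : IsOpen Ω) {k : ℕ} (hv : v ∈ spaceRT 𝒯 k)
    (hcont : ∀ q ∈ spaceM 𝒯 k, ∫ x in Ω, weakDiv Ω v x * q x = 0) :
    ∃ P, IsDivFreePiecewise 𝒯 k v P := by
  have h1 : ∀ T, ∃ (W : Fin d → MvPolynomial (Fin d) ℝ) (Q : MvPolynomial (Fin d) ℝ),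
      T ∈ 𝒯.elements → (∀ i, (W i).totalDegree ≤ k) ∧ Q.totalDegree ≤ k ∧
      ∀ x ∈ openCell T, v x = polyField (fun i => W i + Q * MvPolynomial.X i) x := by
    intro T
    by_cases hT : T ∈ 𝒯.elements
    · obtain ⟨W, Q, hW⟩ := (hv.2 T hT).exists_poly
      exact ⟨W, Q, fun _ => hW⟩
    · exact ⟨0, 0, fun h => absurd h hT⟩
  choose W Q hP using h1
  let P : Finset (Euc d) → Fin d → MvPolynomial (Fin d) ℝ := fun T i =>
    W T i + Q T * MvPolynomial.X i
  have h2 : IsPiecewise 𝒯 v P := fun T hT => (hP T hT).2.2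
  have hdeg : ∀ T ∈ 𝒯.elements, ∀ i, (P T i).totalDegree ≤ k + 1 := by
    intro T hT i
    refine (MvPolynomial.totalDegree_add _ _).trans
      (max_le (((hP T hT).1 i).trans (Nat.le_succ k)) ?_)
    refine (MvPolynomial.totalDegree_mul _ _).trans ?_
    rw [MvPolynomial.totalDegree_X]
    exact Nat.add_le_add_right (hP T hT).2.1 1
  have h3 := h2.polyDiv_eq_zero hd hΩL hΩo hv.1
    (fun T hT => totalDegree_polyDiv_le (hdeg T hT)) hcont
  exact ⟨P, h2,
    fun T hT => totalDegree_le_of_polyDiv_eq_zero hd (hP T hT).1 (hP T hT).2.1 (h3 T hT), h3,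
    hv.1.isDivFree (h2.weakDiv_ae_eq_zero hΩL hΩo hv.1.1 h3)⟩

end HdivUpwind

namespace HdivUpwind

variable {d : ℕ} {Ω : Set (Euc d)} {𝒯 : Triangulation Ω} {β B v : Euc d → Euc d}
  {P P' Q : Finset (Euc d) → Fin d → MvPolynomial (Fin d) ℝ} {T T' : Finset (Euc d)}
  {a a' x : Euc d}

lemma continuous_polyField (R : Fin d → MvPolynomial (Fin d) ℝ) : Continuous (polyField R) :=
  (contDiff_polyField R).continuous

lemma polyField_sub (R R' : Fin d → MvPolynomial (Fin d) ℝ) (x : Euc d) :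
    polyField (fun i => R i - R' i) x = polyField R x - polyField R' x := by
  ext i; simp [polyFun]

/-! ### The convective term -/

/-- The convective term only depends on the polynomials which represent the fields. -/
lemma convTerm_eq (h : IsPiecewise 𝒯 v P) {w : Euc d → Euc d} (hw : IsPiecewise 𝒯 w Q)
    (hB : ∀ x ∈ closure Ω, B x = β x) :
    convTerm 𝒯 β v w = ∑ T ∈ 𝒯.elements, ∫ x in openCell T,
      inner ℝ (polyField (P T) x) (fderiv ℝ (polyField (Q T)) x (B x)) := by
  refine Finset.sum_congr rfl fun T hT => ?_
  refine setIntegral_congr_fun isOpen_interior.measurableSet fun x hx => ?_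
  have h1 : w =ᶠ[𝓝 x] polyField (Q T) := by
    filter_upwards [isOpen_interior.mem_nhds hx] with y hy using hw T hT y hy
  rw [h T hT x hx, h1.fderiv_eq, hB x (Triangulation.convexHull_subset hT (interior_subset hx))]

lemma integrableOn_openCell {h : Euc d → ℝ} (hh : Continuous h) (T : Finset (Euc d)) :
    IntegrableOn h (openCell T) :=
  (hh.continuousOn.integrableOn_compact (isCompact_convexHull_finset T)).mono_set interior_subset

lemma continuous_inner_fderiv_polyField (hB : Continuous B)
    (R R' : Fin d → MvPolynomial (Fin d) ℝ) :
    Continuous fun x => (inner ℝ (polyField R x) (fderiv ℝ (polyField R') x (B x)) : ℝ) :=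
  (continuous_polyField R).inner
    (((contDiff_polyField R').continuous_fderiv (by simp)).clm_apply hB)

lemma convTerm_sub (hBc : Continuous B) (hB : ∀ x ∈ closure Ω, B x = β x) {v' w : Euc d → Euc d}
    (h : IsPiecewise 𝒯 v P) (h' : IsPiecewise 𝒯 v' P') (hw : IsPiecewise 𝒯 w Q) :
    convTerm 𝒯 β v w - convTerm 𝒯 β v' w = convTerm 𝒯 β (fun x => v x - v' x) w := by
  rw [convTerm_eq h hw hB, convTerm_eq h' hw hB, convTerm_eq (h.sub h') hw hB,
    ← Finset.sum_sub_distrib]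
  refine Finset.sum_congr rfl fun T _ => ?_
  rw [← integral_sub (integrableOn_openCell (continuous_inner_fderiv_polyField hBc _ _) T)
    (integrableOn_openCell (continuous_inner_fderiv_polyField hBc _ _) T)]
  simp only [polyField_sub, inner_sub_left]

/-- By the divergence theorem, the convective term tested with the field itself is a boundary term.
-/
lemma convTerm_self (hd : 2 ≤ d) (hΩL : HasLipschitzBoundary Ω) (hΩo : IsOpen Ω)
    (hβ : IsWeakDiv Ω β 0) (hBc : Continuous B) (hB : ∀ x ∈ closure Ω, B x = β x)
    (h : IsPiecewise 𝒯 v P) :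
    convTerm 𝒯 β v v = ∑ T ∈ 𝒯.elements, ∑ a ∈ T, ∫ x in facet T a,
      1 / 2 * (inner ℝ (B x) (outwardNormal T a) *
        inner ℝ (polyField (P T) x) (polyField (P T) x)) ∂(μHE[d - 1] : Measure (Euc d)) := by
  rw [convTerm_eq h h hB]
  refine Finset.sum_congr rfl fun T hT => ?_
  have hTΩ := Triangulation.openCell_subset hΩL hΩo hT
  have hdiv : ∀ ψ : Euc d → ℝ, ContDiff ℝ ∞ ψ → HasCompactSupport ψ → tsupport ψ ⊆ openCell T →
      ∫ x, fderiv ℝ ψ x (B x) = 0 := by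
    intro ψ hψ hψc hψT
    have h1 := hβ.2 ψ hψ hψc (hψT.trans hTΩ)
    simp only [Pi.zero_apply, zero_mul, integral_zero, neg_zero] at h1
    rw [← h1, ← setIntegral_eq_integral_of_forall_compl_eq_zero (s := Ω) (μ := volume)
      (f := fun x => fderiv ℝ ψ x (B x)) fun x hx => by
        rw [fderiv_of_notMem_tsupport (𝕜 := ℝ) fun hs => hx (hTΩ (hψT hs))]; rfl]
    exact setIntegral_congr_fun hΩo.measurableSet fun x hx => by
      simp only [hB x (subset_closure hx)]
  have hφ : ContDiff ℝ ∞ fun x => (inner ℝ (polyField (P T) x) (polyField (P T) x) : ℝ) :=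
    (contDiff_polyField _).inner ℝ (contDiff_polyField _)
  have h2 := (Triangulation.isSimplex hT).integral_fderiv_eq_sum_facetIntegral hd hBc hdiv hφ
  have hdiff := (contDiff_polyField (P T)).differentiable (by simp)
  have h3 : ∀ x, (inner ℝ (polyField (P T) x) (fderiv ℝ (polyField (P T)) x (B x)) : ℝ) =
      1 / 2 * fderiv ℝ (fun x => (inner ℝ (polyField (P T) x) (polyField (P T) x) : ℝ)) x
        (B x) := by
    intro x
    rw [fderiv_inner_apply ℝ (hdiff x) (hdiff x),
      real_inner_comm (polyField (P T) x) (fderiv ℝ (polyField (P T)) x (B x))]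
    ring
  simp only [h3]
  rw [integral_const_mul, h2, Finset.mul_sum]
  refine Finset.sum_congr rfl fun a _ => ?_
  rw [facetIntegral, integral_const_mul]

/-! ### The upwind flux -/

/-- Traces of a piecewise polynomial field from within an element. -/
lemma IsPiecewise.tendsto_trace (h : IsPiecewise 𝒯 v P) (hd : 1 ≤ d) (hT : T ∈ 𝒯.elements)
    (ha : a ∈ T) (hx : x ∈ facetInterior T a) {c : ℝ} (hc : 0 < c) :
    Tendsto (fun ε : ℝ => v (x - ε • (c • outwardNormal T a))) (𝓝[>] 0)
      (𝓝 (polyField (P T) x)) := by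
  have h1 : Continuous fun ε : ℝ => polyField (P T) (x - ε • (c • outwardNormal T a)) :=
    (continuous_polyField _).comp (by fun_prop)
  have h2 := (h1.tendsto 0).mono_left (nhdsWithin_le_nhds (s := Ioi 0))
  simp only [zero_smul, sub_zero] at h2
  refine h2.congr' ?_
  exact ((Triangulation.isSimplex hT).eventually_mem_openCell hd ha hx hc).mono
    fun ε hε => (h T hT _ hε).symm

lemma IsPiecewise.innerTrace_eq (h : IsPiecewise 𝒯 v P) (hd : 1 ≤ d) (hT : T ∈ 𝒯.elements)
    (ha : a ∈ T) (hx : x ∈ facetInterior T a) :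
    innerTrace v (outwardNormal T a) x = polyField (P T) x := by
  have := h.tendsto_trace hd hT ha hx one_pos
  simp only [one_smul] at this
  exact this.limUnder_eq

lemma IsPiecewise.upwindValue_of_pos (h : IsPiecewise 𝒯 v P) (hd : 1 ≤ d) (hT : T ∈ 𝒯.elements)
    (ha : a ∈ T) (hx : x ∈ facetInterior T a) (hc : 0 < inner ℝ (β x) (outwardNormal T a)) :
    upwindValue β v (outwardNormal T a) x = polyField (P T) x :=
  (h.tendsto_trace hd hT ha hx hc).limUnder_eq

lemma IsPiecewise.upwindValue_of_neg (h : IsPiecewise 𝒯 v P) (hd : 1 ≤ d)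
    (hT' : T' ∈ 𝒯.elements) (ha' : a' ∈ T') (hx : x ∈ facetInterior T' a')
    (hn : outwardNormal T' a' = -outwardNormal T a)
    (hc : inner ℝ (β x) (outwardNormal T a) < 0) :
    upwindValue β v (outwardNormal T a) x = polyField (P T') x := by
  have h1 := h.tendsto_trace hd hT' ha' hx (neg_pos.2 hc)
  rw [hn] at h1
  simp only [smul_neg, neg_smul, neg_neg] at h1
  exact h1.limUnder_eq

open Classical in
/-- The element which shares with `T` the facet opposite to `a`, or `T` itself if there is none.
The latter happens only on the boundary, where `β · n = 0` makes the choice irrelevant. -/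
noncomputable def neighbor (𝒯 : Triangulation Ω) (T : Finset (Euc d)) (a : Euc d) :
    Finset (Euc d) :=
  if h : ∃ T' ∈ 𝒯.elements, T' ≠ T ∧ ∃ a' ∈ T', T'.erase a' = T.erase a then h.choose else T

lemma neighbor_eq (hd : 1 ≤ d) (hT : T ∈ 𝒯.elements) (hT' : T' ∈ 𝒯.elements) (hne : T' ≠ T)
    (ha : a ∈ T) (ha' : a' ∈ T') (h : T'.erase a' = T.erase a) : neighbor 𝒯 T a = T' := by
  have hex : ∃ T' ∈ 𝒯.elements, T' ≠ T ∧ ∃ a' ∈ T', T'.erase a' = T.erase a :=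
    ⟨T', hT', hne, a', ha', h⟩
  have h1 : neighbor 𝒯 T a = hex.choose := dif_pos hex
  obtain ⟨h2, h3, a'', h4, h5⟩ := hex.choose_spec
  rw [h1]
  exact (Triangulation.eq_or_eq_of_erase_eq hd hT hT' h2 ha ha' h4 hne h h5).resolve_left h3

lemma facet_congr (h : T'.erase a' = T.erase a) : facet T' a' = facet T a := by
  rw [facet, facet, ← Finset.coe_erase, ← Finset.coe_erase, h]

/-- The integrand of the upwind flux in terms of the polynomials that represent the two fields. -/
noncomputable def fluxDensity (𝒯 : Triangulation Ω) (β : Euc d → Euc d)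
    (P Q : Finset (Euc d) → Fin d → MvPolynomial (Fin d) ℝ) (T : Finset (Euc d)) (a x : Euc d) :
    ℝ :=
  max (inner ℝ (β x) (outwardNormal T a)) 0 * inner ℝ (polyField (P T) x) (polyField (Q T) x) +
  min (inner ℝ (β x) (outwardNormal T a)) 0 *
    inner ℝ (polyField (P (neighbor 𝒯 T a)) x) (polyField (Q T) x)

lemma continuous_fluxDensity (hB : Continuous B) : Continuous (fluxDensity 𝒯 B P Q T a) := by
  have h1 : Continuous fun x => (inner ℝ (B x) (outwardNormal T a) : ℝ) :=
    hB.inner continuous_const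
  exact ((h1.max continuous_const).mul
      ((continuous_polyField _).inner (continuous_polyField _))).add
    ((h1.min continuous_const).mul ((continuous_polyField _).inner (continuous_polyField _)))

/-- The limits in the upwind flux exist at all relatively interior points of a facet where
`β · n ≠ 0`, and their values are those of the polynomials on the two adjacent elements. -/
lemma fluxTerm_eq (hd : 2 ≤ d) (hΩo : IsOpen Ω) (hβn : 𝒯.NormalVanishes β)
    (hB : ∀ x ∈ closure Ω, B x = β x) {w : Euc d → Euc d} (h : IsPiecewise 𝒯 v P)
    (hw : IsPiecewise 𝒯 w Q) :
    fluxTerm 𝒯 β v w = ∑ T ∈ 𝒯.elements, ∑ a ∈ T, ∫ x in facet T a,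
      fluxDensity 𝒯 B P Q T a x ∂(μHE[d - 1] : Measure (Euc d)) := by
  have hd1 : 1 ≤ d := by omega
  refine Finset.sum_congr rfl fun T hT => Finset.sum_congr rfl fun a ha => ?_
  have hs := Triangulation.isSimplex hT
  have hFΩ : ∀ x ∈ facet T a, B x = β x := fun x hx =>
    hB x (Triangulation.convexHull_subset hT (convexHull_mono sdiff_subset hx))
  by_cases hF : facet T a ⊆ frontier Ω
  · refine setIntegral_congr_fun (measurableSet_facet T a) fun x hx => ?_
    simp only [fluxDensity, hFΩ x hx, hβn T hT a ha hF x hx]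
    simp
  · obtain ⟨T', hT', hne, a', ha', he⟩ := Triangulation.exists_neighbor hd1 hΩo hT ha hF
    have hn := Triangulation.outwardNormal_neighbor hd1 hT hT' hne ha ha' he
    have h1 := (Triangulation.isSimplex hT').ae_facet_bary_pos hd ha'
    rw [facet_congr he] at h1
    refine integral_congr_ae ?_
    filter_upwards [hs.ae_facet_bary_pos hd ha, h1, ae_restrict_mem (measurableSet_facet T a)]
      with x hx hx' hxF
    simp only [fluxDensity, hFΩ x hxF, neighbor_eq hd1 hT hT' hne ha ha' he]
    rw [hw.innerTrace_eq hd1 hT ha hx]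
    rcases lt_trichotomy (inner ℝ (β x) (outwardNormal T a)) 0 with hc | hc | hc
    · rw [h.upwindValue_of_neg hd1 hT' ha' hx' hn hc, max_eq_right hc.le, min_eq_left hc.le]
      ring
    · rw [hc]; simp
    · rw [h.upwindValue_of_pos hd1 hT ha hx hc, max_eq_left hc.le, min_eq_right hc.le]
      ring

lemma fluxTerm_sub (hd : 2 ≤ d) (hΩo : IsOpen Ω) (hβn : 𝒯.NormalVanishes β)
    (hBc : Continuous B) (hB : ∀ x ∈ closure Ω, B x = β x) {v' w : Euc d → Euc d}
    (h : IsPiecewise 𝒯 v P) (h' : IsPiecewise 𝒯 v' P') (hw : IsPiecewise 𝒯 w Q) :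
    fluxTerm 𝒯 β v w - fluxTerm 𝒯 β v' w = fluxTerm 𝒯 β (fun x => v x - v' x) w := by
  rw [fluxTerm_eq hd hΩo hβn hB h hw, fluxTerm_eq hd hΩo hβn hB h' hw,
    fluxTerm_eq hd hΩo hβn hB (h.sub h') hw, ← Finset.sum_sub_distrib]
  refine Finset.sum_congr rfl fun T hT => ?_
  rw [← Finset.sum_sub_distrib]
  refine Finset.sum_congr rfl fun a ha => ?_
  have hs := Triangulation.isSimplex hT
  rw [← integral_sub (hs.integrableOn_facet (by omega) ha (continuous_fluxDensity hBc))
    (hs.integrableOn_facet (by omega) ha (continuous_fluxDensity hBc))]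
  refine integral_congr_ae (ae_of_all _ fun x => ?_)
  simp only [fluxDensity, polyField_sub, inner_sub_left]
  ring

/-! ### Coercivity -/

/-- The contributions of the two sides of an interior facet add up to
`|β · n| |[v]|² / 2`, where `[v]` is the jump of `v`. -/
lemma fluxDensity_add_eq (hn : outwardNormal T' a' = -outwardNormal T a)
    (hN : neighbor 𝒯 T a = T') (hN' : neighbor 𝒯 T' a' = T) :
    (fluxDensity 𝒯 B P P T a x - 1 / 2 * (inner ℝ (B x) (outwardNormal T a) *
        inner ℝ (polyField (P T) x) (polyField (P T) x))) +
      (fluxDensity 𝒯 B P P T' a' x - 1 / 2 * (inner ℝ (B x) (outwardNormal T' a') *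
        inner ℝ (polyField (P T') x) (polyField (P T') x))) =
    1 / 2 * |inner ℝ (B x) (outwardNormal T a)| *
      inner ℝ (polyField (P T) x - polyField (P T') x)
        (polyField (P T) x - polyField (P T') x) := by
  simp only [fluxDensity, hn, hN, hN', inner_neg_right, inner_sub_left, inner_sub_right]
  rw [real_inner_comm (polyField (P T) x) (polyField (P T') x)]
  rcases le_total (inner ℝ (B x) (outwardNormal T a)) 0 with hc | hc
  · rw [max_eq_right hc, min_eq_left hc, max_eq_left (neg_nonneg.2 hc),
      min_eq_right (neg_nonneg.2 hc), abs_of_nonpos hc]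
    ring
  · rw [max_eq_left hc, min_eq_right hc, max_eq_right (neg_nonpos.2 hc),
      min_eq_left (neg_nonpos.2 hc), abs_of_nonneg hc]
    ring

/-- The upwind discretisation of convection is positive semidefinite. -/
theorem convTerm_self_le_fluxTerm_self (hd : 2 ≤ d) (hΩL : HasLipschitzBoundary Ω)
    (hΩo : IsOpen Ω) (hβ : IsWeakDiv Ω β 0) (hβn : 𝒯.NormalVanishes β) (hBc : Continuous B)
    (hB : ∀ x ∈ closure Ω, B x = β x) (h : IsPiecewise 𝒯 v P) :
    convTerm 𝒯 β v v ≤ fluxTerm 𝒯 β v v := by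
  have hd1 : 1 ≤ d := by omega
  let D : Finset (Euc d) → Euc d → Euc d → ℝ := fun T a x =>
    fluxDensity 𝒯 B P P T a x - 1 / 2 * (inner ℝ (B x) (outwardNormal T a) *
        inner ℝ (polyField (P T) x) (polyField (P T) x))
  have hgc : ∀ T a, Continuous fun x => 1 / 2 * (inner ℝ (B x) (outwardNormal T a) *
        inner ℝ (polyField (P T) x) (polyField (P T) x) : ℝ) := fun T a =>
    continuous_const.mul ((hBc.inner continuous_const).mul
      ((continuous_polyField _).inner (continuous_polyField _)))
  have hDc : ∀ T a, Continuous (D T a) := fun T a => (continuous_fluxDensity hBc).sub (hgc T a)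
  let I : (_ : Finset (Euc d)) × Euc d → ℝ := fun p =>
    ∫ x in facet p.1 p.2, D p.1 p.2 x ∂(μHE[d - 1] : Measure (Euc d))
  have hsum : fluxTerm 𝒯 β v v - convTerm 𝒯 β v v =
      ∑ p ∈ 𝒯.elements.sigma fun T => T, I p := by
    rw [fluxTerm_eq hd hΩo hβn hB h h, convTerm_self hd hΩL hΩo hβ hBc hB h,
      ← Finset.sum_sub_distrib, Finset.sum_sigma]
    refine Finset.sum_congr rfl fun T hT => ?_
    rw [← Finset.sum_sub_distrib]
    refine Finset.sum_congr rfl fun a ha => ?_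
    have hs := Triangulation.isSimplex hT
    exact (integral_sub (hs.integrableOn_facet hd1 ha (continuous_fluxDensity hBc))
      (hs.integrableOn_facet hd1 ha (hgc T a))).symm
  rw [← sub_nonneg, hsum, ← Finset.sum_fiberwise_of_maps_to
    (g := fun p : (_ : Finset (Euc d)) × Euc d => p.1.erase p.2)
    (fun p hp => Finset.mem_image_of_mem _ hp)]
  refine Finset.sum_nonneg fun F hF => ?_
  obtain ⟨⟨T, a⟩, hp, rfl⟩ := Finset.mem_image.1 hF
  obtain ⟨hT, ha⟩ := Finset.mem_sigma.1 hp
  simp only at hT ha ⊢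
  by_cases hFΩ : facet T a ⊆ frontier Ω
  · refine Finset.sum_nonneg fun p hp' => le_of_eq ?_
    obtain ⟨hp', he⟩ := Finset.mem_filter.1 hp'
    obtain ⟨hT', ha'⟩ := Finset.mem_sigma.1 hp'
    symm
    refine setIntegral_eq_zero_of_forall_eq_zero fun x hx => ?_
    have h1 := hβn p.1 hT' p.2 ha' (by rw [facet_congr he]; exact hFΩ) x hx
    rw [← hB x (Triangulation.convexHull_subset hT' (convexHull_mono sdiff_subset hx))] at h1
    simp only [D, fluxDensity, h1]
    simp
  · obtain ⟨T', hT', hne, a', ha', he⟩ := Triangulation.exists_neighbor hd1 hΩo hT ha hFΩ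
    have hfib : (𝒯.elements.sigma fun T => T).filter (fun p => p.1.erase p.2 = T.erase a) =
        {⟨T, a⟩, ⟨T', a'⟩} := by
      ext ⟨T'', a''⟩
      simp only [Finset.mem_filter, Finset.mem_sigma, Finset.mem_insert, Finset.mem_singleton]
      constructor
      · rintro ⟨⟨hT'', ha''⟩, he''⟩
        rcases Triangulation.eq_or_eq_of_erase_eq hd1 hT hT' hT'' ha ha' ha'' hne he he'' with
          rfl | rfl
        · left; rw [eq_of_erase_eq_erase ha'' he'']
        · right; rw [eq_of_erase_eq_erase ha'' (he''.trans he.symm)]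
      · rintro (h1 | h1) <;> obtain ⟨rfl, h2⟩ := Sigma.mk.inj h1 <;> obtain rfl := eq_of_heq h2
        · exact ⟨⟨hT, ha⟩, rfl⟩
        · exact ⟨⟨hT', ha'⟩, he⟩
    rw [hfib, Finset.sum_pair (fun h1 => hne (Sigma.mk.inj h1).1.symm)]
    simp only [I, facet_congr he]
    have hs := Triangulation.isSimplex hT
    rw [← integral_add (hs.integrableOn_facet hd1 ha (hDc T a))
      (hs.integrableOn_facet hd1 ha (hDc T' a'))]
    refine integral_nonneg fun x => ?_
    simp only [D]
    rw [fluxDensity_add_eq (Triangulation.outwardNormal_neighbor hd1 hT hT' hne ha ha' he)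
      (neighbor_eq hd1 hT hT' hne ha ha' he) (neighbor_eq hd1 hT' hT hne.symm ha' ha he.symm)]
    exact mul_nonneg (by positivity) real_inner_self_nonneg

end HdivUpwind

theorem proposition4p1 (d : ℕ) (hd : d = 2 ∨ d = 3)
    (Ω : Set (HdivUpwind.Euc d)) (hΩo : IsOpen Ω) (hΩc : IsConnected Ω)
    (hΩL : HdivUpwind.HasLipschitzBoundary Ω) (𝒯 : HdivUpwind.Triangulation Ω)
    (β : HdivUpwind.Euc d → HdivUpwind.Euc d) (hβc : ContinuousOn β (closure Ω))
    (hβdiv : HdivUpwind.IsWeakDiv Ω β 0) (hβn : 𝒯.NormalVanishes β)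
    (σ : HdivUpwind.Euc d → ℝ) (hσ : MemLp σ ⊤ (volume.restrict Ω))
    (hσ₀ : ∃ σ₀ : ℝ, 0 < σ₀ ∧ ∀ᵐ x ∂(volume.restrict Ω), σ₀ ≤ σ x)
    (f : HdivUpwind.Euc d → HdivUpwind.Euc d) (hf : MemLp f 2 (volume.restrict Ω))
    (k : ℕ) (hk : 1 ≤ k)
    (u u' : HdivUpwind.Euc d → HdivUpwind.Euc d) (p p' : HdivUpwind.Euc d → ℝ)
    (hRT : HdivUpwind.IsUpwindSolution 𝒯 β σ f
      (HdivUpwind.spaceRT 𝒯 k) (HdivUpwind.spaceM 𝒯 k) u p)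
    (hBDM : HdivUpwind.IsUpwindSolution 𝒯 β σ f
      (HdivUpwind.spaceBDM 𝒯 k) (HdivUpwind.spaceM 𝒯 (k - 1)) u' p') :
    u =ᵐ[volume.restrict Ω] u' := by
  have hd2 : 2 ≤ d := by omega
  have hd1 : 1 ≤ d := by omega
  obtain ⟨P, hP⟩ := HdivUpwind.exists_isDivFreePiecewise_of_mem_spaceRT hd1 hΩL hΩo
    hRT.velocity_mem hRT.continuity
  obtain ⟨P', hP'⟩ := HdivUpwind.exists_isDivFreePiecewise_of_mem_spaceBDM hd1 hΩL hΩo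
    hBDM.velocity_mem hBDM.continuity
  -- The difference is an admissible test function in both methods.
  have hW := hP.sub hP'
  set w : HdivUpwind.Euc d → HdivUpwind.Euc d := fun x => u x - u' x with hw
  have hw0 := hW.weakDiv_ae_eq_zero hΩL hΩo
  have hpres : ∀ q : HdivUpwind.Euc d → ℝ, ∫ x in Ω, q x * HdivUpwind.weakDiv Ω w x = 0 := by
    intro q
    refine integral_eq_zero_of_ae (hw0.mono fun x hx => ?_)
    simp only [hx, Pi.zero_apply, mul_zero]
  have e1 := hRT.momentum w (hW.mem_spaceRT hΩL hΩo)
  have e2 := hBDM.momentum w (hW.mem_spaceBDM hΩL hΩo)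
  rw [hpres, sub_zero] at e1 e2
  -- A continuous extension of `β` to the whole space makes all integrands continuous.
  obtain ⟨B, hB⟩ := ContinuousMap.exists_restrict_eq isClosed_closure
    (⟨(closure Ω).domRestrict β, hβc.domRestrict⟩ : C(closure Ω, HdivUpwind.Euc d))
  have hB' : ∀ x ∈ closure Ω, B x = β x := fun x hx => DFunLike.congr_fun hB ⟨x, hx⟩
  have hconv := HdivUpwind.convTerm_sub B.continuous hB' hP.isPiecewise hP'.isPiecewise
    hW.isPiecewise
  have hflux := HdivUpwind.fluxTerm_sub hd2 hΩo hβn B.continuous hB' hP.isPiecewise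
    hP'.isPiecewise hW.isPiecewise
  have hpos := HdivUpwind.convTerm_self_le_fluxTerm_self hd2 hΩL hΩo hβdiv hβn B.continuous hB'
    hW.isPiecewise
  rw [← hw] at hconv hflux
  have hint : ∀ v : HdivUpwind.Euc d → HdivUpwind.Euc d, MemLp v 2 (volume.restrict Ω) →
      IntegrableOn (fun x => σ x * inner ℝ (v x) (w x)) Ω := by
    intro v hv
    have hvw : Integrable (fun x => (inner ℝ (v x) (w x) : ℝ)) (volume.restrict Ω) :=
      (hv.norm.integrable_mul hW.isDivFree.1.norm).mono'
        (hv.1.inner hW.isDivFree.1.1) (ae_of_all _ fun x => norm_inner_le_norm _ _)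
    exact hσ.integrable_mul (q := 1) (memLp_one_iff_integrable.2 hvw)
  have hreact : (∫ x in Ω, σ x * inner ℝ (u x) (w x)) - ∫ x in Ω, σ x * inner ℝ (u' x) (w x) =
      ∫ x in Ω, σ x * inner ℝ (w x) (w x) := by
    rw [← integral_sub (hint u hP.isDivFree.1) (hint u' hP'.isDivFree.1)]
    refine integral_congr_ae (ae_of_all _ fun x => ?_)
    simp only [hw, inner_sub_left]
    ring
  have hle : ∫ x in Ω, σ x * inner ℝ (w x) (w x) ≤ 0 := by linarith
  obtain ⟨σ₀, hσ₀, hσσ₀⟩ := hσ₀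
  have hnn : 0 ≤ᵐ[volume.restrict Ω] fun x => σ x * inner ℝ (w x) (w x) :=
    hσσ₀.mono fun x hx => mul_nonneg (hσ₀.le.trans hx) real_inner_self_nonneg
  have hzero := (integral_eq_zero_iff_of_nonneg_ae hnn (hint w hW.isDivFree.1)).1
    (le_antisymm hle (integral_nonneg_of_ae hnn))
  filter_upwards [hzero, hσσ₀] with x hx hσx
  have h1 := (mul_eq_zero.1 hx).resolve_left (hσ₀.trans_le hσx).ne'
  exact sub_eq_zero.1 (inner_self_eq_zero.1 h1)
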